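/- Let $A$ be a finite dimensional algebra over a field $k$, let $\mathrm{mod}A$ be the category of finitely generated left $A$-modules, and let $\mathrm{Gproj}A\subseteq\mathrm{mod}A$ be the full subcategory of Gorenstein-projective modules, i.e. of modules $G\cong\mathrm{Ker}\,d^0$ for some exact sequence $\cdots\to P^{-1}\to P^0\xrightarrow{d^0}P^1\to\cdots$ of finitely generated projective $A$-modules that stays exact under $\mathrm{Hom}_A(-,P)$ for every finitely generated projective $P$. Assume that $A$ is of finite CM-type: up to isomorphism there are only finitely many indecomposable modules $E_1,\dots,E_n$ in $\mathrm{Gproj}A$. Put $E=\bigoplus_{i=1}^nE_i$, let $\Gamma=A(\mathrm{Gproj})=\mathrm{End}_A(E)^{op}$ be the CM-Auslander algebra, and let $D=\mathrm{Hom}_k(-,k)$. Let $M\in\mathrm{mod}A$. A minimal proper Gorenstein-projective presentation of $M$ is an exact sequence $G_1\xrightarrow{f}G_0\xrightarrow{\pi}M\to0$ with $G_0,G_1\in\mathrm{Gproj}A$ such that $\mathrm{Hom}_A(G,G_1)\to\mathrm{Hom}_A(G,G_0)\to\mathrm{Hom}_A(G,M)\to0$ is exact for all $G\in\mathrm{Gproj}A$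 and such that $G_1\to\mathrm{Im}f$ and $\pi$ are right minimal (a map $g$ is right minimal if every endomorphism $\varphi$ with $g\varphi=g$ is an isomorphism). For such a presentation put $$\tau_GM=\mathrm{Ker}\big(D\mathrm{Hom}_A(G_1,E)\to D\mathrm{Hom}_A(G_0,E)\big),$$ a left $\Gamma$-module. Call $M$ $\tau_G$-rigid if $\mathrm{Hom}_\Gamma(\mathrm{Hom}_A(E,M),\tau_GM)=0$. Let $\tau$ be the Auslander–Reiten translation of $\Gamma$, that is, $\tau N=\mathrm{Ker}(D\mathrm{Hom}_\Gamma(P_1,\Gamma)\to D\mathrm{Hom}_\Gamma(P_0,\Gamma))$ for the minimal projective presentation $P_1\to P_0\to N\to0$, and call a finitely generated left $\Gamma$-module $N$ $\tau$-rigid if $\mathrm{Hom}_\Gamma(N,\tau N)=0$. Let $\mathrm{Gen}_GM$ be the class of $Y\in\mathrm{mod}A$ for which there is an epimorphism $g:T_0\to Y$, with $T_0$ a direct summand of a direct sum of copies of $M$, such that $\mathrm{Hom}_A(G,g)$ is epic for all $G\in\mathrm{Gproj}A$. Then $M$ has a minimal proper Gorenstein-projective presentation, and for every such presentation $G_1\xrightarrow{f}G_0\to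 M\to0$, with $\tau_GM$ computed from it, the following hold. 1. $M$ is $\tau_G$-rigid if and only if $\mathrm{Hom}_A(f,M):\mathrm{Hom}_A(G_0,M)\to\mathrm{Hom}_A(G_1,M)$ is an epimorphism. 2. $M$ is $\tau_G$-rigid if and only if $\mathrm{Hom}_A(E,M)$ is a $\tau$-rigid $\Gamma$-module. 3. $\tau_GM\cong\tau\,\mathrm{Hom}_A(E,M)$ as $\Gamma$-modules. 4. If $M$ is $\tau_G$-rigid, then for every $Y\in\mathrm{Gen}_GM$ the finitely generated $\Gamma$-module $X=\mathrm{Hom}_A(E,Y)$ satisfies $\overline{\mathrm{Hom}}_\Gamma(X,\tau_GM)=0$, i.e. every $\Gamma$-homomorphism $X\to\tau_GM$ factors through a finitely generated injective $\Gamma$-module. -/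

import Mathlib

universe u

namespace RelAR

/-! ### Gorenstein-projective modules -/

section Gorenstein

variable (A : Type u) [Ring A]

/-- The finitely generated `A`-module `G` is Gorenstein-projective: it is isomorphic to `Ker d⁰` for
an exact sequence `⋯ → P⁻¹ → P⁰ → P¹ → ⋯` of finitely generated projective modules which stays exact
under `Hom_A(-, Q)` for every finitely generated projective module `Q`. -/
def IsGproj (G : Type u) [AddCommGroup G] [Module A G] : Prop :=
  Module.Finite A G ∧
    ∃ (P : ℤ → ModuleCat.{u} A) (d : ∀ i : ℤ, P i →ₗ[A] P (i + 1)),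
      (∀ i, Module.Finite A (P i) ∧ Module.Projective A (P i)) ∧
      (∀ i, Function.Exact (d i) (d (i + 1))) ∧
      (∀ Q : ModuleCat.{u} A, Module.Finite A Q → Module.Projective A Q → ∀ i,
        Function.Exact (fun φ : P (i + 1 + 1) →ₗ[A] Q => φ ∘ₗ d (i + 1))
          (fun φ : P (i + 1) →ₗ[A] Q => φ ∘ₗ d i)) ∧
      Nonempty (G ≃ₗ[A] LinearMap.ker (d 0))

/-- A nonzero module that is not the direct sum of two nonzero submodules. -/
def IsIndecomposable (X : Type u) [AddCommGroup X] [Module A X] : Prop :=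
  Nontrivial X ∧ ∀ p q : Submodule A X, IsCompl p q → p = ⊥ ∨ q = ⊥

/-- `F 0, …, F (n - 1)` is a complete list, without repetition up to isomorphism, of the
indecomposable finitely generated Gorenstein-projective `A`-modules. -/
def IsCompleteGprojList {n : ℕ} (F : Fin n → ModuleCat.{u} A) : Prop :=
  (∀ i, IsGproj A (F i) ∧ IsIndecomposable A (F i)) ∧
  (∀ i j, Nonempty (F i ≃ₗ[A] F j) → i = j) ∧
  (∀ X : ModuleCat.{u} A, IsGproj A X → IsIndecomposable A X → ∃ i, Nonempty (X ≃ₗ[A] F i))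

/-- `E` is the direct sum of a finite complete irredundant list of indecomposable finitely generated
Gorenstein-projective modules. (Such an `E` exists precisely when `A` is of finite CM-type.) -/
def IsGprojGenerator (E : Type u) [AddCommGroup E] [Module A E] : Prop :=
  ∃ (n : ℕ) (F : Fin n → ModuleCat.{u} A),
    IsCompleteGprojList A F ∧ Nonempty (E ≃ₗ[A] ∀ i, F i)

end Gorenstein

/-! ### Minimal presentations -/

section Presentations

variable {R : Type u} [Ring R]

/-- `g` is right minimal: every endomorphism `φ` of its source with `g φ = g` is an isomorphism. -/
def RightMinimal {X Y : Type u} [AddCommGroup X] [Module R X] [AddCommGroup Y] [Module R Y]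
    (g : X →ₗ[R] Y) : Prop :=
  ∀ φ : X →ₗ[R] X, g ∘ₗ φ = g → Function.Bijective φ

/-- A minimal proper `𝒳`-presentation `X₁ --f--> X₀ --π--> M → 0`: an exact sequence with `X₁`, `X₀`
in `𝒳` that stays exact under `Hom(X, -)` for all `X` in `𝒳`, and such that `X₀ → M` and
`X₁ → Im f` (which therefore are right `𝒳`-approximations) are right minimal. -/
structure MinimalPresentation (𝒳 : ModuleCat.{u} R → Prop)
    (M : Type u) [AddCommGroup M] [Module R M] where
  X₁ : ModuleCat.{u} R
  X₀ : ModuleCat.{u} R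
  f : X₁ →ₗ[R] X₀
  π : X₀ →ₗ[R] M
  mem₁ : 𝒳 X₁
  mem₀ : 𝒳 X₀
  exact : Function.Exact f π
  surjective : Function.Surjective π
  hom_exact : ∀ X : ModuleCat.{u} R, 𝒳 X →
    Function.Exact (fun h : X →ₗ[R] X₁ => f ∘ₗ h) (fun h : X →ₗ[R] X₀ => π ∘ₗ h)
  hom_surjective : ∀ X : ModuleCat.{u} R, 𝒳 X →
    Function.Surjective (fun h : X →ₗ[R] X₀ => π ∘ₗ h)
  minimal₁ : RightMinimal f.rangeRestrict
  minimal₀ : RightMinimal π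

/-- A minimal proper Gorenstein-projective presentation of the `R`-module `M`. -/
abbrev MinimalGprojPresentation (R : Type u) [Ring R] (M : Type u) [AddCommGroup M] [Module R M] :=
  MinimalPresentation (fun X : ModuleCat.{u} R => IsGproj R X) M

/-- A minimal projective presentation of the `R`-module `M` (by finitely generated projectives). -/
abbrev MinimalProjPresentation (R : Type u) [Ring R] (M : Type u) [AddCommGroup M] [Module R M] :=
  MinimalPresentation (fun X : ModuleCat.{u} R => Module.Finite R X ∧ Module.Projective R X) M

theorem exists_minimal_projective_cover [IsArtinianRing R]
    (N : Type u) [AddCommGroup N] [Module R N] [Module.Finite R N] :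
    ∃ (P : ModuleCat.{u} R) (p : P →ₗ[R] N), (Module.Finite R P ∧ Module.Projective R P) ∧
      Function.Surjective p ∧ RightMinimal p := by
  let S : Set ℕ∞ := {l | ∃ (P : ModuleCat.{u} R) (p : P →ₗ[R] N), (Module.Finite R P ∧
    Module.Projective R P) ∧ Function.Surjective p ∧ Module.length R P = l}
  have hS : S.Nonempty := by
    obtain ⟨n, g, hg⟩ := Module.Finite.exists_fin' R N
    exact ⟨_, ModuleCat.of R (Fin n → R), g, ⟨inferInstanceAs (Module.Finite R (Fin n → R)),
      inferInstanceAs (Module.Projective R (Fin n → R))⟩, hg, rfl⟩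
  obtain ⟨P, p, ⟨hf, hp⟩, hs, hl⟩ := wellFounded_lt.min_mem S hS
  refine ⟨P, p, ⟨hf, hp⟩, hs, fun φ hφ => ?_⟩
  have hpow : ∀ n, p ∘ₗ (φ ^ n : Module.End R P) = p := by
    intro n
    induction n with
    | zero => ext; simp
    | succ n ih =>
      ext x
      have h1 := LinearMap.congr_fun ih (φ x)
      have h2 := LinearMap.congr_fun hφ x
      simp only [LinearMap.comp_apply] at h1 h2 ⊢
      rw [pow_succ, Module.End.mul_apply, h1, h2]
  obtain ⟨n, hn⟩ := Filter.eventually_atTop.1 (LinearMap.eventually_isCompl_ker_pow_range_pow φ)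
  have hc := hn (n + 1) (Nat.le_succ n)
  set Q := LinearMap.range (φ ^ (n + 1) : Module.End R P) with hQ
  have htop : Q = ⊤ := by
    by_contra hne
    have hlt := Submodule.length_lt (R := R) hne
    have hproj : Module.Projective R Q :=
      Module.Projective.of_split Q.subtype (Submodule.projectionOnto Q _ hc.symm)
        (by ext x; simp)
    have hmem : Module.length R Q ∈ S := by
      refine ⟨ModuleCat.of R Q, p ∘ₗ Q.subtype, ⟨inferInstanceAs (Module.Finite R Q), hproj⟩, ?_, rfl⟩
      intro y
      obtain ⟨x, rfl⟩ := hs y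
      exact ⟨⟨(φ ^ (n + 1) : Module.End R P) x, x, rfl⟩, LinearMap.congr_fun (hpow (n + 1)) x⟩
    rw [hl] at hlt
    exact wellFounded_lt.not_lt_min S hmem hlt
  have hsurj : Function.Surjective φ := by
    intro y
    have hy : y ∈ Q := htop ▸ Submodule.mem_top
    obtain ⟨x, hx⟩ := hy
    exact ⟨(φ ^ n : Module.End R P) x, by rw [← hx, pow_succ', Module.End.mul_apply]⟩
  exact ⟨IsNoetherian.injective_of_surjective_endomorphism φ hsurj, hsurj⟩

theorem nonempty_minimalProjPresentation [IsArtinianRing R]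
    (N : Type u) [AddCommGroup N] [Module R N] [Module.Finite R N] :
    Nonempty (MinimalProjPresentation R N) := by
  obtain ⟨P₀, p, ⟨hf, hp⟩, hs, hm⟩ := exists_minimal_projective_cover (R := R) N
  obtain ⟨P₁, q, h1, hqs, hqm⟩ := exists_minimal_projective_cover (R := R) (LinearMap.ker p)
  refine ⟨⟨P₁, P₀, (LinearMap.ker p).subtype ∘ₗ q, p, h1, ⟨hf, hp⟩, ?_, hs, ?_, ?_, ?_, hm⟩⟩
  · intro x
    constructor
    · intro hx
      obtain ⟨y, hy⟩ := hqs ⟨x, hx⟩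
      exact ⟨y, by simp [hy]⟩
    · rintro ⟨y, rfl⟩
      exact (q y).2
  · intro X hX g
    have := hX.2
    constructor
    · intro hg
      obtain ⟨h, hh⟩ := Module.projective_lifting_property q
        (g.codRestrict (LinearMap.ker p) (fun x => LinearMap.congr_fun hg x)) hqs
      refine ⟨h, ?_⟩
      ext x
      exact congrArg Subtype.val (LinearMap.congr_fun hh x)
    · rintro ⟨h, rfl⟩
      ext x
      exact (q (h x)).2
  · intro X hX g
    have := hX.2
    exact Module.projective_lifting_property p g hs
  · intro φ hφ
    refine hqm φ ?_
    ext x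
    have hx := congrArg Subtype.val (LinearMap.congr_fun hφ x)
    exact hx

end Presentations

/-! ### Duals of `Hom` modules and Auslander–Reiten translates -/

section Dual

variable (k A W X : Type u) [Field k] [Ring A] [Algebra k A]
  [AddCommGroup W] [Module k W] [Module A W] [IsScalarTower k A W]
  [AddCommGroup X] [Module A X]

/-- `D Hom_A(X, W)`, where `D = Hom_k(-, k)`. -/
def DHom : Type u := Module.Dual k (X →ₗ[A] W)

instance : AddCommGroup (DHom k A W X) := inferInstanceAs (AddCommGroup (Module.Dual k (X →ₗ[A] W)))

variable (Γ : Type u) [Ring Γ] [Module Γᵐᵒᵖ W] [SMulCommClass A Γᵐᵒᵖ W] [SMulCommClass k Γᵐᵒᵖ W]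

/-- The right action of `γ : Γ` on `Hom_A(X, W)` for an `A`-`Γ`-bimodule `W`. -/
def rightMul (γ : Γ) : (X →ₗ[A] W) →ₗ[k] (X →ₗ[A] W) where
  toFun h := MulOpposite.op γ • h
  map_add' h h' := smul_add _ h h'
  map_smul' c h := by
    ext x
    exact (smul_comm c (MulOpposite.op γ) (h x)).symm

/-- If `W` is an `A`-`Γ`-bimodule, then `Hom_A(X, W)` is a right `Γ`-module and its dual is a left
`Γ`-module through `(γ • φ) h = φ (h γ)`. -/
instance : Module Γ (DHom k A W X) where
  smul γ φ := LinearMap.comp (show Module.Dual k (X →ₗ[A] W) from φ) (rightMul k A W X Γ γ)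
  one_smul φ := by
    refine LinearMap.ext fun h => congrArg (show Module.Dual k (X →ₗ[A] W) from φ) ?_
    exact one_smul _ h
  mul_smul a b φ := by
    refine LinearMap.ext fun h => congrArg (show Module.Dual k (X →ₗ[A] W) from φ) ?_
    exact mul_smul (MulOpposite.op b) (MulOpposite.op a) h
  smul_zero γ := LinearMap.ext fun _ => rfl
  smul_add γ φ ψ := LinearMap.ext fun _ => rfl
  add_smul a b φ := by
    refine LinearMap.ext fun h => ?_
    refine (congrArg (show Module.Dual k (X →ₗ[A] W) from φ)
      (add_smul (MulOpposite.op a) (MulOpposite.op b) h)).trans ?_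
    exact map_add (show Module.Dual k (X →ₗ[A] W) from φ) _ _
  zero_smul φ := by
    refine LinearMap.ext fun h => ?_
    refine (congrArg (show Module.Dual k (X →ₗ[A] W) from φ)
      (zero_smul Γᵐᵒᵖ h)).trans ?_
    exact map_zero (show Module.Dual k (X →ₗ[A] W) from φ)

variable {A X}
variable {X₁ X₀ : Type u} [AddCommGroup X₁] [Module A X₁] [AddCommGroup X₀] [Module A X₀]

/-- The map `D Hom_A(X₁, W) → D Hom_A(X₀, W)` induced by `f : X₁ → X₀`. -/
def DHom.map (f : X₁ →ₗ[A] X₀) : DHom k A W X₁ →ₗ[Γ] DHom k A W X₀ where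
  toFun φ := LinearMap.comp (show Module.Dual k (X₁ →ₗ[A] W) from φ)
    ({ toFun := fun h => h ∘ₗ f
       map_add' := fun _ _ => rfl
       map_smul' := fun _ _ => rfl } : (X₀ →ₗ[A] W) →ₗ[k] (X₁ →ₗ[A] W))
  map_add' _ _ := rfl
  map_smul' _ _ := rfl

/-- The `Γ`-module `Ker (D Hom_A(X₁, W) → D Hom_A(X₀, W))` attached to `f : X₁ → X₀`. -/
abbrev dualKernel (f : X₁ →ₗ[A] X₀) : Submodule Γ (DHom k A W X₁) :=
  LinearMap.ker (DHom.map k W Γ f)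

end Dual

section Tau

variable (k Λ : Type u) [Field k] [Ring Λ] [Algebra k Λ] [Module.Finite k Λ]
  (N : Type u) [AddCommGroup N] [Module Λ N] [Module.Finite Λ N]

/-- A chosen minimal projective presentation of `N` (it is unique up to isomorphism). -/
noncomputable def minimalProjPresentation : MinimalProjPresentation Λ N :=
  haveI : IsArtinianRing Λ := IsArtinianRing.of_finite k Λ
  Classical.choice (nonempty_minimalProjPresentation N)

/-- The Auslander–Reiten translate `τ N` over the finite dimensional `k`-algebra `Λ`: the kernel of
`D Hom_Λ(P₁, Λ) → D Hom_Λ(P₀, Λ)` for the minimal projective presentation `P₁ → P₀ → N → 0`. -/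
noncomputable abbrev tau : Submodule Λ (DHom k Λ Λ (minimalProjPresentation k Λ N).X₁) :=
  dualKernel k Λ Λ (minimalProjPresentation k Λ N).f

/-- `N` is `τ`-rigid: `Hom_Λ(N, τ N) = 0`. -/
def IsTauRigid : Prop := ∀ φ : N →ₗ[Λ] tau k Λ N, φ = 0

end Tau

/-! ### The Cohen–Macaulay Auslander algebra and the relative translate -/

section Relative

variable (k A E : Type u) [Field k] [Ring A] [Algebra k A]
  [AddCommGroup E] [Module k E] [Module A E] [IsScalarTower k A E]

/-- `End_A(E)ᵒᵖ`; for the Gorenstein-projective generator `E` this is the CM-Auslander algebra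
`A(Gproj)`. -/
abbrev CMAuslander (A E : Type u) [Ring A] [AddCommGroup E] [Module A E] : Type u :=
  (Module.End A E)ᵐᵒᵖ

/-- `E` is a right `End_A(E)ᵒᵖ`-module through evaluation. -/
instance : Module (CMAuslander A E)ᵐᵒᵖ E where
  smul s x := s.unop.unop x
  one_smul _ := rfl
  mul_smul _ _ _ := rfl
  smul_zero s := map_zero s.unop.unop
  smul_add s := map_add s.unop.unop
  add_smul _ _ _ := rfl
  zero_smul _ := rfl

instance : SMulCommClass A (CMAuslander A E)ᵐᵒᵖ E where
  smul_comm a s x := (map_smul s.unop.unop a x).symm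

instance : SMulCommClass k (CMAuslander A E)ᵐᵒᵖ E where
  smul_comm c s x := by
    rw [← algebraMap_smul A c x, ← algebraMap_smul A c (s • x)]
    exact smul_comm _ s x

variable (M : Type u) [AddCommGroup M] [Module A M]

/-- `Hom_A(E, M)` is a left `End_A(E)ᵒᵖ`-module through precomposition. -/
instance : Module (CMAuslander A E) (E →ₗ[A] M) where
  smul s h := h ∘ₗ s.unop
  one_smul _ := rfl
  mul_smul _ _ _ := rfl
  smul_zero _ := rfl
  smul_add _ _ _ := rfl
  add_smul s t h := LinearMap.ext fun x => map_add h (s.unop x) (t.unop x)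
  zero_smul h := LinearMap.ext fun _ => map_zero h

theorem finite_hom [Module.Finite k A] [Module k M] [IsScalarTower k A M]
    [Module.Finite A E] [Module.Finite A M] : Module.Finite k (E →ₗ[A] M) := by
  have : Module.Finite k E := Module.Finite.trans A E
  have : Module.Finite k M := Module.Finite.trans A M
  let r : (E →ₗ[A] M) →ₗ[k] (E →ₗ[k] M) :=
    { toFun := fun h => h.restrictScalars k
      map_add' := fun _ _ => rfl
      map_smul' := fun _ _ => rfl }
  exact Module.Finite.of_injective r fun _ _ h => LinearMap.ext fun x => LinearMap.congr_fun h x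

instance [Module.Finite k A] [Module.Finite A E] : Module.Finite k (CMAuslander A E) := by
  have : Module.Finite k (Module.End A E) := finite_hom k A E E
  exact Module.Finite.equiv (MulOpposite.opLinearEquiv k : Module.End A E ≃ₗ[k] _)

theorem finite_hom_CMAuslander [Module.Finite k A] [Module.Finite A E] [Module.Finite A M] :
    Module.Finite (CMAuslander A E) (E →ₗ[A] M) := by
  let _ : Module k M := Module.compHom M (algebraMap k A)
  have : IsScalarTower k A M := IsScalarTower.of_algebraMap_smul fun _ _ => rfl
  have : Module.Finite k (E →ₗ[A] M) := finite_hom k A E M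
  have : IsScalarTower k (CMAuslander A E) (E →ₗ[A] M) :=
    ⟨fun c s h => LinearMap.ext fun x => by
      change h (c • s.unop x) = c • h (s.unop x)
      rw [← algebraMap_smul A c (s.unop x), map_smul, algebraMap_smul]⟩
  exact Module.Finite.of_restrictScalars_finite k (CMAuslander A E) (E →ₗ[A] M)

variable {A M}

/-- The relative translate `τ_G M`, computed from a minimal proper Gorenstein-projective
presentation `G₁ → G₀ → M → 0`: the kernel of `D Hom_A(G₁, E) → D Hom_A(G₀, E)`. -/
abbrev tauG (P : MinimalGprojPresentation A M) : Submodule (CMAuslander A E) (DHom k A E P.X₁) :=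
  dualKernel k E (CMAuslander A E) P.f

variable (A M)

/-- `M` is `τ_G`-rigid: `Hom_{A(Gproj)}(Hom_A(E, M), τ_G M) = 0`, where `τ_G M` is computed from a
minimal proper Gorenstein-projective presentation (unique up to isomorphism). -/
def IsTauGRigid : Prop :=
  ∃ P : MinimalGprojPresentation A M,
    ∀ φ : (E →ₗ[A] M) →ₗ[CMAuslander A E] tauG k E P, φ = 0

/-- `T` belongs to `Add M`: it is a direct summand of a direct sum of copies of `M`. -/
def InAdd (T : Type u) [AddCommGroup T] [Module A T] : Prop :=
  ∃ (I : Type u) (i : T →ₗ[A] (I →₀ M)) (r : (I →₀ M) →ₗ[A] T), r ∘ₗ i = LinearMap.id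

/-- `Y` belongs to `Gen_G M`: there is a `G`-exact sequence `T₀ → Y → 0` with `T₀` in `Add M`. -/
def InGenG (Y : Type u) [AddCommGroup Y] [Module A Y] : Prop :=
  ∃ (T₀ : ModuleCat.{u} A) (g : T₀ →ₗ[A] Y), InAdd A M T₀ ∧ Function.Surjective g ∧
    ∀ G : ModuleCat.{u} A, IsGproj A G → Function.Surjective (fun h : G →ₗ[A] T₀ => g ∘ₗ h)

end Relative

/-- The finitely generated `Γ`-module `X` satisfies `Hom_Γ(X, T) = 0` modulo injectives: every map
`X → T` factors through a finitely generated injective `Γ`-module. -/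
def InStablePerp (Γ : Type u) [Ring Γ] (T X : Type u) [AddCommGroup T] [Module Γ T]
    [AddCommGroup X] [Module Γ X] : Prop :=
  Module.Finite Γ X ∧ ∀ φ : X →ₗ[Γ] T, ∃ (I : ModuleCat.{u} Γ) (a : X →ₗ[Γ] I) (b : I →ₗ[Γ] T),
    Module.Finite Γ I ∧ Module.Injective Γ I ∧ φ = b ∘ₗ a

end RelAR

/-! The functor `Hom_A(E, -)` restricts to an equivalence from `Gproj A` to the finitely generated
projective `Γ`-modules. A proper Gorenstein-projective presentation of `M` is one that stays exact
under this functor, and right minimality passes through the equivalence, so a minimal proper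
presentation of `M` becomes a minimal projective presentation of `Hom_A(E, M)`
(`MinimalPresentation.exists_projective_hom`). Since `Hom_Γ(Hom_A(E, X), Γ)` is `Hom_A(X, E)` for
`X` in `add E`, the kernels defining `τ_G M` and `τ Hom_A(E, M)` agree; this gives 3, and 2 follows.

For 1, `D Hom_A(X, M) ≅ Hom_Γ(Hom_A(E, M), D Hom_A(X, E))` naturally for `X` in `add E`. Taking
kernels along `f` identifies `Hom_Γ(Hom_A(E, M), τ_G M)` with the dual of the cokernel of `Hom_A(f,
M)` (`forall_hom_dualKernel_eq_zero_iff`).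

For 4, more is true: `Hom_Γ(Hom_A(E, Y), τ_G M) = 0`, because every map `E → Y` is a finite sum of
maps factoring through `M` (`InGenG.hom_eq_zero`). The zero module then serves as the injective.

All this needs `Gproj A = add E`. Splitting a module into indecomposables requires `Gproj A` to be
closed under direct summands (`IsGproj.of_retract`), which is proved directly from complete
resolutions through closure under extensions. Approximations by `E^n` exist because `Hom_A(E, M)` is
finitely generated over `Γ`; one of least length is right minimal. -/

namespace RelAR

/-! ### Factoring linear maps, and two-sided chains -/

section LinearAlgebra

variable {R : Type*} [Ring R] {X Y Z : Type*} [AddCommGroup X] [Module R X]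
  [AddCommGroup Y] [Module R Y] [AddCommGroup Z] [Module R Z]

theorem exists_comp_eq_of_surjective {f : X →ₗ[R] Y} (hf : Function.Surjective f) (g : X →ₗ[R] Z)
    (h : ∀ x, f x = 0 → g x = 0) : ∃ l : Y →ₗ[R] Z, l ∘ₗ f = g := by
  refine ⟨(LinearMap.ker f).liftQ g h ∘ₗ (f.quotKerEquivOfSurjective hf).symm, ?_⟩
  ext x
  have : (f.quotKerEquivOfSurjective hf).symm (f x) = (LinearMap.ker f).mkQ x := by
    rw [LinearEquiv.symm_apply_eq]
    rfl
  rw [LinearMap.comp_apply, LinearMap.comp_apply, LinearEquiv.coe_coe, this]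
  rfl

theorem exists_comp_eq_of_injective {i : X →ₗ[R] Y} (hi : Function.Injective i) (g : Z →ₗ[R] Y)
    (h : ∀ z, ∃ x, i x = g z) : ∃ l : Z →ₗ[R] X, i ∘ₗ l = g := by
  refine ⟨(LinearEquiv.ofInjective i hi).symm ∘ₗ g.codRestrict (LinearMap.range i) h, ?_⟩
  ext z
  have := LinearEquiv.apply_symm_apply (LinearEquiv.ofInjective i hi)
    (g.codRestrict (LinearMap.range i) h z)
  exact congrArg Subtype.val this

end LinearAlgebra

theorem exists_int_chain {α : Type*} {r : α → α → Prop} (hr : ∀ x, ∃ y, r x y)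
    (hl : ∀ x, ∃ y, r y x) (x : α) : ∃ Z : ℤ → α, Z 0 = x ∧ ∀ i, r (Z i) (Z (i + 1)) := by
  choose s hs using hr
  choose t ht using hl
  -- `Int.negSucc n` is `-(n + 1)`, hence `n + 1` steps to the left.
  refine ⟨fun i => Int.rec (fun n => s^[n] x) (fun n => t^[n + 1] x) i, rfl, fun i => ?_⟩
  cases i with
  | ofNat n =>
    change r (s^[n] x) (s^[n + 1] x)
    rw [Function.iterate_succ_apply']
    exact hs _
  | negSucc n =>
    cases n with
    | zero => exact ht x
    | succ n =>
      change r (t^[n + 1 + 1] x) (t^[n + 1] x)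
      rw [Function.iterate_succ_apply' t (n + 1)]
      exact ht _

/-! ### Closure properties of Gorenstein-projective modules -/

section Gproj

variable {A : Type u} [Ring A]

/-- There is a short exact sequence `0 → X → P → C → 0` with `P` finitely generated projective such
that every map from `X` to a finitely generated projective module extends to `P`. -/
def ProjStep (X C : ModuleCat.{u} A) : Prop :=
  ∃ (P : ModuleCat.{u} A) (i : X →ₗ[A] P) (p : P →ₗ[A] C),
    Module.Finite A P ∧ Module.Projective A P ∧ Function.Injective i ∧ Function.Surjective p ∧
    Function.Exact i p ∧
    ∀ Q : ModuleCat.{u} A, Module.Finite A Q → Module.Projective A Q →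
      ∀ φ : X →ₗ[A] Q, ∃ ψ : P →ₗ[A] Q, ψ ∘ₗ i = φ

theorem ProjStep.of_equiv {X X' C : ModuleCat.{u} A} (h : ProjStep X C) (e : X' ≃ₗ[A] X) :
    ProjStep X' C := by
  obtain ⟨P, i, p, h1, h2, hi, hp, he, hq⟩ := h
  refine ⟨P, i ∘ₗ e.toLinearMap, p, h1, h2, hi.comp e.injective, hp, ?_, fun Q hQ hQ' φ => ?_⟩
  · intro y
    rw [he y]
    constructor
    · rintro ⟨x, rfl⟩
      exact ⟨e.symm x, by simp⟩
    · rintro ⟨x, rfl⟩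
      exact ⟨e x, rfl⟩
  · obtain ⟨ψ, hψ⟩ := hq Q hQ hQ' (φ ∘ₗ e.symm.toLinearMap)
    refine ⟨ψ, ?_⟩
    rw [← LinearMap.comp_assoc, hψ]
    ext x
    simp

theorem ProjStep.of_equiv_right {X C C' : ModuleCat.{u} A} (h : ProjStep X C) (e : C ≃ₗ[A] C') :
    ProjStep X C' := by
  obtain ⟨P, i, p, h1, h2, hi, hp, he, hq⟩ := h
  refine ⟨P, i, e.toLinearMap ∘ₗ p, h1, h2, hi, e.surjective.comp hp, ?_, hq⟩
  intro y
  rw [← he y]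
  simp

theorem IsGproj.of_equiv {X Y : Type u} [AddCommGroup X] [Module A X] [AddCommGroup Y] [Module A Y]
    (h : IsGproj A X) (e : Y ≃ₗ[A] X) : IsGproj A Y := by
  obtain ⟨h1, P, d, hP, hd, hQ, ⟨e'⟩⟩ := h
  exact ⟨Module.Finite.equiv e.symm, P, d, hP, hd, hQ, ⟨e.trans e'⟩⟩

/-- Splicing the short exact sequences `Z j → P j → Z (j + 1)` gives a complete resolution; the
extension property of each step is what keeps it exact under `Hom(-, Q)`. -/
theorem isGproj_of_chain (Z : ℤ → ModuleCat.{u} A) (hZ : ∀ i, ProjStep (Z i) (Z (i + 1))) :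
    IsGproj A (Z 0) := by
  choose P i p h1 h2 hi hp he hq using hZ
  refine ⟨?_, P, fun j => i (j + 1) ∘ₗ p j, fun j => ⟨h1 j, h2 j⟩, fun j => ?_,
    fun Q hQ hQ' j => ?_, ⟨?_⟩⟩
  · have := h1 (-1)
    exact Module.Finite.of_surjective (p (-1)) (hp (-1))
  · intro y
    constructor
    · intro hy
      obtain ⟨x, rfl⟩ := (he (j + 1) y).1 (hi (j + 1 + 1) (hy.trans (map_zero _).symm))
      obtain ⟨z, rfl⟩ := hp j x
      exact ⟨z, rfl⟩
    · rintro ⟨x, rfl⟩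
      have := (he (j + 1) _).2 ⟨p j x, rfl⟩
      simp [this]
  · intro φ
    constructor
    · intro hφ
      have hφ' : φ ∘ₗ i (j + 1) = 0 := by
        ext x
        obtain ⟨z, rfl⟩ := hp j x
        exact LinearMap.congr_fun hφ z
      obtain ⟨l, hl⟩ := exists_comp_eq_of_surjective (hp (j + 1)) φ fun x hx => by
        obtain ⟨z, rfl⟩ := (he (j + 1) x).1 hx
        exact LinearMap.congr_fun hφ' z
      obtain ⟨ψ, hψ⟩ := hq (j + 1 + 1) Q hQ hQ' l
      refine ⟨ψ, ?_⟩
      change ψ ∘ₗ i (j + 1 + 1) ∘ₗ p (j + 1) = φ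
      rw [← LinearMap.comp_assoc, hψ, hl]
    · rintro ⟨ψ, rfl⟩
      ext x
      have := (he (j + 1) _).2 ⟨p j x, rfl⟩
      simp [this]
  · have hk : LinearMap.ker (i (0 + 1) ∘ₗ p 0) = LinearMap.range (i 0) := by
      rw [LinearMap.ker_comp_of_ker_eq_bot _ (LinearMap.ker_eq_bot.2 (hi _))]
      exact (he 0).linearMap_ker_eq
    exact (LinearEquiv.ofInjective (i 0) (hi 0)).trans (LinearEquiv.ofEq _ _ hk.symm)

theorem IsGproj.exists_chain {G : Type u} [AddCommGroup G] [Module A G] (h : IsGproj A G) :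
    ∃ Z : ℤ → ModuleCat.{u} A, (∀ i, ProjStep (Z i) (Z (i + 1))) ∧ Nonempty (G ≃ₗ[A] Z 0) := by
  obtain ⟨-, P, d, hP, hd, hQ, he⟩ := h
  refine ⟨fun i => ModuleCat.of A (LinearMap.ker (d i)), fun i => ?_, he⟩
  -- A map on `Ker (d i)` is extended by pulling it back to `P (i - 1)`, where it kills the image of
  -- `d (i - 2)`; writing `i = j + 1 + 1` makes the indices agree definitionally.
  obtain ⟨j, rfl⟩ : ∃ j, i = j + 1 + 1 := ⟨i - 2, by ring⟩
  refine ⟨P (j + 1 + 1), (LinearMap.ker (d (j + 1 + 1))).subtype,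
    (d (j + 1 + 1)).codRestrict _ fun x => (hd (j + 1 + 1) _).2 ⟨x, rfl⟩, (hP _).1, (hP _).2,
    Subtype.val_injective, ?_, ?_, fun Q hQ1 hQ2 φ => ?_⟩
  · rintro ⟨y, hy⟩
    obtain ⟨x, rfl⟩ := (hd (j + 1 + 1) y).1 hy
    exact ⟨x, rfl⟩
  · intro y
    constructor
    · intro hy
      exact ⟨⟨y, congrArg Subtype.val hy⟩, rfl⟩
    · rintro ⟨x, rfl⟩
      exact Subtype.ext x.2
  · let c := (d (j + 1)).codRestrict (LinearMap.ker (d (j + 1 + 1)))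
      fun x => (hd (j + 1) _).2 ⟨x, rfl⟩
    obtain ⟨ψ, hψ⟩ := (hQ Q hQ1 hQ2 j (φ ∘ₗ c)).1 (by
      ext x
      have : c (d j x) = 0 := Subtype.ext ((hd j _).2 ⟨x, rfl⟩)
      simp [this])
    refine ⟨ψ, ?_⟩
    refine LinearMap.ext ?_
    rintro ⟨y, hy⟩
    obtain ⟨x, rfl⟩ := (hd (j + 1) y).1 hy
    exact LinearMap.congr_fun hψ x

theorem IsGproj.exists_step_right {X : ModuleCat.{u} A} (h : IsGproj A X) :
    ∃ C : ModuleCat.{u} A, IsGproj A C ∧ ProjStep X C := by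
  obtain ⟨Z, hZ, ⟨e⟩⟩ := h.exists_chain
  exact ⟨Z (0 + 1), isGproj_of_chain (fun i => Z (i + 1)) fun i => hZ (i + 1), (hZ 0).of_equiv e⟩

theorem IsGproj.exists_step_left {X : ModuleCat.{u} A} (h : IsGproj A X) :
    ∃ K : ModuleCat.{u} A, IsGproj A K ∧ ProjStep K X := by
  obtain ⟨Z, hZ, ⟨e⟩⟩ := h.exists_chain
  refine ⟨Z (0 - 1), isGproj_of_chain (fun i => Z (i - 1)) fun i => ?_, ?_⟩
  · have := hZ (i - 1)
    rwa [sub_add_eq_add_sub] at this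
  · have h := hZ (0 - 1)
    rw [sub_add_cancel] at h
    exact h.of_equiv_right e.symm

/-- A coinductive principle: to see that a class consists of Gorenstein-projectives, it suffices to
take one step right and one step left without leaving the class. The closure properties below are
reduced to such single steps. -/
theorem isGproj_of_class (𝒞 : ModuleCat.{u} A → Prop)
    (hr : ∀ X, 𝒞 X → ∃ C, 𝒞 C ∧ ProjStep X C) (hl : ∀ X, 𝒞 X → ∃ K, 𝒞 K ∧ ProjStep K X)
    {X : ModuleCat.{u} A} (hX : 𝒞 X) : IsGproj A X := by
  obtain ⟨Z, hZ, hZ'⟩ := exists_int_chain (α := {X : ModuleCat.{u} A // 𝒞 X})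
    (r := fun X Y => ProjStep X.1 Y.1)
    (fun X => let ⟨C, hC, h⟩ := hr X.1 X.2; ⟨⟨C, hC⟩, h⟩)
    (fun X => let ⟨C, hC, h⟩ := hl X.1 X.2; ⟨⟨C, hC⟩, h⟩) ⟨X, hX⟩
  have := isGproj_of_chain (fun i => (Z i).1) hZ'
  rwa [hZ] at this

theorem isGproj_of_projective (X : ModuleCat.{u} A) (h : Module.Finite A X)
    (h' : Module.Projective A X) : IsGproj A X := by
  refine isGproj_of_class (fun X => Module.Finite A X ∧ Module.Projective A X) ?_ ?_ ⟨h, h'⟩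
  · rintro X ⟨h1, h2⟩
    refine ⟨ModuleCat.of A PUnit.{u + 1}, ⟨inferInstanceAs (Module.Finite A PUnit.{u + 1}),
      inferInstanceAs (Module.Projective A PUnit.{u + 1})⟩, X, LinearMap.id, 0, h1, h2,
      Function.injective_id, fun y => ⟨0, Subsingleton.elim (α := PUnit.{u + 1}) _ _⟩,
      fun y => ⟨fun _ => ⟨y, rfl⟩, fun _ => rfl⟩, fun Q _ _ φ => ⟨φ, rfl⟩⟩
  · rintro X ⟨h1, h2⟩
    refine ⟨ModuleCat.of A PUnit.{u + 1}, ⟨inferInstanceAs (Module.Finite A PUnit.{u + 1}),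
      inferInstanceAs (Module.Projective A PUnit.{u + 1})⟩, X, 0, LinearMap.id, h1, h2,
      fun _ _ _ => Subsingleton.elim (α := PUnit.{u + 1}) _ _, Function.surjective_id,
      fun y => ⟨fun h => ⟨0, h.symm⟩, ?_⟩, fun Q _ _ φ => ⟨0, ?_⟩⟩
    · rintro ⟨_, rfl⟩
      rfl
    · ext x
      have : x = 0 := Subsingleton.elim (α := PUnit.{u + 1}) _ _
      simp [this]

/-- Maps into finitely generated projectives extend along monomorphisms with Gorenstein-projective
cokernel. -/
theorem exists_extension_of_isGproj {X Z Y Q : ModuleCat.{u} A} {i : X →ₗ[A] Z} {p : Z →ₗ[A] Y}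
    (hi : Function.Injective i) (hp : Function.Surjective p) (he : Function.Exact i p)
    (hY : IsGproj A Y) (hQ : Module.Finite A Q) (hQ' : Module.Projective A Q) (a : X →ₗ[A] Q) :
    ∃ b : Z →ₗ[A] Q, b ∘ₗ i = a := by
  -- This is `Ext¹(Y, Q) = 0`. With `0 → K → R → Y → 0`, the module `Z` is the pushout of `j : K →
  -- R` along some `w : K → X`, so `a` and an extension `v` of `a ∘ w` to `R` glue to a map on `Z`.
  obtain ⟨K, -, R, j, s, -, hR, hj, hs, hjs, hext⟩ := hY.exists_step_left
  obtain ⟨t, ht⟩ := Module.projective_lifting_property p s hp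
  obtain ⟨w, hw⟩ := exists_comp_eq_of_injective hi (t ∘ₗ j) fun k => by
    refine (he _).1 ?_
    have := LinearMap.congr_fun ht (j k)
    simp only [LinearMap.comp_apply] at this ⊢
    rw [this]
    exact (hjs _).2 ⟨k, rfl⟩
  obtain ⟨v, hv⟩ := hext Q hQ hQ' (a ∘ₗ w)
  have hsurj : Function.Surjective (i.coprod t) := by
    intro z
    obtain ⟨r, hr⟩ := hs (p z)
    obtain ⟨x, hx⟩ := (he (z - t r)).1 (by
      rw [map_sub, ← hr, ← LinearMap.comp_apply p t, ht, sub_self])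
    exact ⟨(x, r), by simp [hx]⟩
  obtain ⟨b, hb⟩ := exists_comp_eq_of_surjective hsurj (a.coprod v) (by
    rintro ⟨x, r⟩ hxr
    simp only [LinearMap.coprod_apply] at hxr ⊢
    obtain ⟨k, rfl⟩ := (hjs r).1 (by
      have h1 := congrArg p hxr
      rw [map_add, (he _).2 ⟨x, rfl⟩, zero_add, map_zero, ← LinearMap.comp_apply p t, ht] at h1
      exact h1)
    have h2 := LinearMap.congr_fun hw k
    have h3 := LinearMap.congr_fun hv k
    simp only [LinearMap.comp_apply] at h2 h3
    have h4 : x + w k = 0 := hi (by rw [map_add, h2, hxr, map_zero])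
    rw [h3, ← map_add, h4, map_zero])
  refine ⟨b, ?_⟩
  ext x
  have := LinearMap.congr_fun hb (x, 0)
  simpa using this

/-- The horseshoe lemma for embeddings into projectives. Projectives need not be injective, so
extending `X → P` to `Z` relies on `exists_extension_of_isGproj`. -/
theorem exists_step_right_of_extension {X Z Y : ModuleCat.{u} A} {i : X →ₗ[A] Z} {p : Z →ₗ[A] Y}
    (hi : Function.Injective i) (hp : Function.Surjective p) (he : Function.Exact i p)
    (hX : IsGproj A X) (hY : IsGproj A Y) :
    ∃ (C C'' C' : ModuleCat.{u} A) (i' : C →ₗ[A] C'') (p' : C'' →ₗ[A] C'),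
      Function.Injective i' ∧ Function.Surjective p' ∧ Function.Exact i' p' ∧
      IsGproj A C ∧ IsGproj A C' ∧ ProjStep Z C'' := by
  obtain ⟨C, hC, P, a, q, h1, h2, ha, hq, haq, hext⟩ := hX.exists_step_right
  obtain ⟨C', hC', P', a', q', h1', h2', ha', hq', haq', hext'⟩ := hY.exists_step_right
  obtain ⟨b, hb⟩ := exists_extension_of_isGproj hi hp he hY h1 h2 a
  have hbi (x) : b (i x) = a x := LinearMap.congr_fun hb x
  have hpi (x) : p (i x) = 0 := (he _).2 ⟨x, rfl⟩
  let m : Z →ₗ[A] P × P' := b.prod (a' ∘ₗ p)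
  obtain ⟨i', hi'⟩ := exists_comp_eq_of_surjective hq
    ((LinearMap.range m).mkQ ∘ₗ LinearMap.inl A P P') (by
      intro y hy
      obtain ⟨x, rfl⟩ := (haq y).1 hy
      simp only [LinearMap.comp_apply, Submodule.mkQ_apply, Submodule.Quotient.mk_eq_zero]
      exact ⟨i x, by simp [m, hbi, hpi]⟩)
  have hi'' (y) : i' (q y) = (LinearMap.range m).mkQ (y, 0) := LinearMap.congr_fun hi' y
  let p' : (P × P') ⧸ LinearMap.range m →ₗ[A] C' :=
    (LinearMap.range m).liftQ (q' ∘ₗ LinearMap.snd A P P') (by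
      rintro _ ⟨z, rfl⟩
      exact (haq' _).2 ⟨p z, rfl⟩)
  refine ⟨C, ModuleCat.of A ((P × P') ⧸ LinearMap.range m), C', i', p', ?_, ?_, ?_, hC, hC',
    ModuleCat.of A (P × P'), m, (LinearMap.range m).mkQ, inferInstanceAs (Module.Finite A (P × P')),
    inferInstanceAs (Module.Projective A (P × P')), ?_, Submodule.mkQ_surjective _, ?_,
    fun Q hQ hQ' φ => ?_⟩
  · refine (injective_iff_map_eq_zero i').2 fun c hc => ?_
    obtain ⟨y, rfl⟩ := hq c
    have hy : (y, (0 : P')) ∈ LinearMap.range m := by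
      rw [← Submodule.Quotient.mk_eq_zero]
      exact (hi'' y).symm.trans hc
    obtain ⟨z, hz⟩ := hy
    obtain ⟨hz1, hz2⟩ := Prod.ext_iff.1 hz
    have hz3 : p z = 0 := ha' (hz2.trans (map_zero a').symm)
    obtain ⟨x, rfl⟩ := (he z).1 hz3
    refine (haq y).2 ⟨x, ?_⟩
    rw [← hbi]
    exact hz1
  · intro c
    obtain ⟨y, rfl⟩ := hq' c
    exact ⟨(LinearMap.range m).mkQ (0, y), rfl⟩
  · intro c
    obtain ⟨⟨y, y'⟩, rfl⟩ := Submodule.mkQ_surjective _ c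
    constructor
    · intro hc
      obtain ⟨y₁, rfl⟩ := (haq' y').1 hc
      obtain ⟨z, rfl⟩ := hp y₁
      refine ⟨q (y - b z), ?_⟩
      rw [hi'', Submodule.mkQ_apply, Submodule.mkQ_apply, Submodule.Quotient.eq]
      exact ⟨-z, by simp [m]⟩
    · rintro ⟨c₁, hc₁⟩
      obtain ⟨y₁, rfl⟩ := hq c₁
      rw [← hc₁, hi'']
      exact map_zero q'
  · refine (injective_iff_map_eq_zero m).2 fun z hz => ?_
    obtain ⟨hz1, hz2⟩ := Prod.ext_iff.1 hz
    have hz3 : p z = 0 := ha' (hz2.trans (map_zero a').symm)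
    obtain ⟨x, rfl⟩ := (he z).1 hz3
    have : x = 0 := ha (by rw [← hbi, map_zero]; exact hz1)
    simp [this]
  · exact LinearMap.exact_map_mkQ_range m
  -- Extend `φ` on `X` first; the remaining error vanishes on `X`, so it factors through `Y` and
  -- extends to `P'`.
  · obtain ⟨ψ, hψ⟩ := hext Q hQ hQ' (φ ∘ₗ i)
    obtain ⟨χ, hχ⟩ := exists_comp_eq_of_surjective hp (φ - ψ ∘ₗ b) fun z hz => by
      obtain ⟨x, rfl⟩ := (he z).1 hz
      have := LinearMap.congr_fun hψ x
      simp only [LinearMap.comp_apply] at this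
      simp [hbi, this]
    obtain ⟨χ', hχ'⟩ := hext' Q hQ hQ' χ
    refine ⟨ψ.coprod χ', ?_⟩
    ext z
    have h3 := LinearMap.congr_fun hχ' (p z)
    have h4 := LinearMap.congr_fun hχ z
    simp only [LinearMap.comp_apply, LinearMap.sub_apply] at h3 h4
    change ψ (b z) + χ' (a' (p z)) = φ z
    rw [h3, h4, add_sub_cancel]

/-- The usual horseshoe lemma: `P × P'` covers `Z`, and its kernel is an extension of `K'` by `K`.
-/
theorem exists_step_left_of_extension {X Z Y : ModuleCat.{u} A} {i : X →ₗ[A] Z} {p : Z →ₗ[A] Y}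
    (hi : Function.Injective i) (hp : Function.Surjective p) (he : Function.Exact i p)
    (hX : IsGproj A X) (hY : IsGproj A Y) :
    ∃ (K K'' K' : ModuleCat.{u} A) (i' : K →ₗ[A] K'') (p' : K'' →ₗ[A] K'),
      Function.Injective i' ∧ Function.Surjective p' ∧ Function.Exact i' p' ∧
      IsGproj A K ∧ IsGproj A K' ∧ ProjStep K'' Z := by
  obtain ⟨K, hK, P, a, q, h1, h2, ha, hq, haq, hext⟩ := hX.exists_step_left
  obtain ⟨K', hK', P', a', q', h1', h2', ha', hq', haq', hext'⟩ := hY.exists_step_left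
  obtain ⟨t, ht⟩ := Module.projective_lifting_property p q' hp
  have hpt (x) : p (t x) = q' x := LinearMap.congr_fun ht x
  have hpi (x) : p (i x) = 0 := (he _).2 ⟨x, rfl⟩
  have hqa (x) : q (a x) = 0 := (haq _).2 ⟨x, rfl⟩
  let m : P × P' →ₗ[A] Z := (i ∘ₗ q).coprod t
  have hm (x y) : m (x, y) = i (q x) + t y := rfl
  let i' : K →ₗ[A] LinearMap.ker m := LinearMap.codRestrict _ (LinearMap.inl A P P' ∘ₗ a) (by
    intro x
    change m (a x, 0) = 0
    simp [hm, hqa])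
  obtain ⟨p', hp'⟩ := exists_comp_eq_of_injective ha'
    (LinearMap.snd A P P' ∘ₗ (LinearMap.ker m).subtype) (by
      rintro ⟨⟨x, y⟩, hxy⟩
      refine (haq' y).1 ?_
      have h0 := (congrArg p hxy).trans (map_zero p)
      rwa [hm, map_add, hpi, zero_add, hpt] at h0)
  have hp'' (z) : a' (p' z) = z.1.2 := LinearMap.congr_fun hp' z
  have hp's : Function.Surjective p' := by
    intro k
    obtain ⟨x, hx⟩ := (he (t (a' k))).1 (by rw [hpt]; exact (haq' _).2 ⟨k, rfl⟩)
    obtain ⟨y, rfl⟩ := hq x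
    refine ⟨⟨(-y, a' k), by rw [LinearMap.mem_ker, hm, ← hx]; simp⟩, ha' ?_⟩
    rw [hp'']
  have hex : Function.Exact i' p' := by
    rintro ⟨⟨x, y⟩, hxy⟩
    constructor
    · intro h
      have hy : y = 0 := by
        have := hp'' ⟨(x, y), hxy⟩
        rw [h, map_zero] at this
        exact this.symm
      subst hy
      obtain ⟨k, rfl⟩ := (haq x).1 (hi (by
        rwa [LinearMap.mem_ker, hm, map_zero, add_zero, ← map_zero i] at hxy))
      exact ⟨k, rfl⟩
    · rintro ⟨k, hk⟩
      refine ha' ?_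
      rw [hp'', ← hk, map_zero]
      rfl
  refine ⟨K, ModuleCat.of A (LinearMap.ker m), K', i', p', ?_, hp's, hex, hK, hK',
    ModuleCat.of A (P × P'), (LinearMap.ker m).subtype, m, inferInstanceAs (Module.Finite A (P × P')),
    inferInstanceAs (Module.Projective A (P × P')), Subtype.val_injective, ?_, ?_,
    fun Q hQ hQ' φ => ?_⟩
  · intro x y hxy
    exact ha (congrArg (fun z => z.1.1) hxy)
  · intro z
    obtain ⟨y, hy⟩ := hq' (p z)
    obtain ⟨x, hx⟩ := (he (z - t y)).1 (by rw [map_sub, hpt, hy, sub_self])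
    obtain ⟨x, rfl⟩ := hq x
    exact ⟨(x, y), by rw [hm, hx]; simp⟩
  · exact LinearMap.exact_subtype_ker_map m
  · obtain ⟨ψ, hψ⟩ := hext Q hQ hQ' (φ ∘ₗ i')
    obtain ⟨χ, hχ⟩ := exists_comp_eq_of_surjective hp's
      (φ - ψ ∘ₗ LinearMap.fst A P P' ∘ₗ (LinearMap.ker m).subtype) (by
        intro z hz
        obtain ⟨k, rfl⟩ := (hex z).1 hz
        exact sub_eq_zero.2 (LinearMap.congr_fun hψ k).symm)
    obtain ⟨χ', hχ'⟩ := hext' Q hQ hQ' χ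
    refine ⟨ψ.coprod χ', ?_⟩
    refine LinearMap.ext fun (z : LinearMap.ker m) => ?_
    have h3 := LinearMap.congr_fun hχ' (p' z)
    have h4 := LinearMap.congr_fun hχ z
    simp only [LinearMap.comp_apply, LinearMap.sub_apply, hp''] at h3 h4
    change ψ z.1.1 + χ' z.1.2 = φ z
    rw [h3, h4]
    exact add_sub_cancel _ _

/-- Gorenstein-projective modules are closed under extensions. -/
theorem IsGproj.of_exact {X Z Y : ModuleCat.{u} A} {i : X →ₗ[A] Z} {p : Z →ₗ[A] Y}
    (hi : Function.Injective i) (hp : Function.Surjective p) (he : Function.Exact i p)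
    (hX : IsGproj A X) (hY : IsGproj A Y) : IsGproj A Z := by
  -- The class of all such extensions is stable under both kinds of step.
  refine isGproj_of_class (fun Z => ∃ (X Y : ModuleCat.{u} A) (i : X →ₗ[A] Z) (p : Z →ₗ[A] Y),
    Function.Injective i ∧ Function.Surjective p ∧ Function.Exact i p ∧ IsGproj A X ∧ IsGproj A Y)
    ?_ ?_ ⟨X, Y, i, p, hi, hp, he, hX, hY⟩
  · rintro Z ⟨X, Y, i, p, hi, hp, he, hX, hY⟩
    obtain ⟨C, C'', C', i', p', h1, h2, h3, h4, h5, h6⟩ :=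
      exists_step_right_of_extension hi hp he hX hY
    exact ⟨C'', ⟨C, C', i', p', h1, h2, h3, h4, h5⟩, h6⟩
  · rintro Z ⟨X, Y, i, p, hi, hp, he, hX, hY⟩
    obtain ⟨C, C'', C', i', p', h1, h2, h3, h4, h5, h6⟩ :=
      exists_step_left_of_extension hi hp he hX hY
    exact ⟨C'', ⟨C, C', i', p', h1, h2, h3, h4, h5⟩, h6⟩

/-- Embed `X` in `P` through `G` and let `C = P / X`. Nothing shows yet that `C` is
Gorenstein-projective, but `0 → G → C × X → C' → 0` is exact, so `C` is again a direct summand of a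
Gorenstein-projective module. -/
theorem exists_step_right_of_retract {X G : ModuleCat.{u} A} (hG : IsGproj A G) {s : X →ₗ[A] G}
    {r : G →ₗ[A] X} (hrs : r ∘ₗ s = LinearMap.id) :
    ∃ C : ModuleCat.{u} A, IsGproj A (C × X) ∧ ProjStep X C := by
  obtain ⟨C', hC', P, a, q, h1, h2, ha, hq, haq, hext⟩ := hG.exists_step_right
  have hrs' (x) : r (s x) = x := LinearMap.congr_fun hrs x
  have hqa (x) : q (a x) = 0 := (haq _).2 ⟨x, rfl⟩
  let N := LinearMap.range (a ∘ₗ s)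
  let q' : P ⧸ N →ₗ[A] C' := N.liftQ q (by rintro _ ⟨z, rfl⟩; exact hqa _)
  refine ⟨ModuleCat.of A (P ⧸ N), IsGproj.of_exact (X := G) (Y := C')
    (Z := ModuleCat.of A ((P ⧸ N) × X)) (i := (N.mkQ ∘ₗ a).prod r)
    (p := q' ∘ₗ LinearMap.fst A (P ⧸ N) X) ?_ ?_ ?_ hG hC',
    P, a ∘ₗ s, N.mkQ, h1, h2, ha.comp (Function.LeftInverse.injective hrs'),
    Submodule.mkQ_surjective _, LinearMap.exact_map_mkQ_range _, fun Q hQ hQ' φ => ?_⟩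
  · refine (injective_iff_map_eq_zero _).2 fun g hg => ?_
    obtain ⟨hg1, hg2⟩ := Prod.ext_iff.1 hg
    obtain ⟨x, hx⟩ := (Submodule.Quotient.mk_eq_zero N).1 hg1
    obtain rfl : s x = g := ha hx
    have : x = 0 := (hrs' x).symm.trans hg2
    simp [this]
  · intro c
    obtain ⟨y, rfl⟩ := hq c
    exact ⟨(N.mkQ y, 0), rfl⟩
  · rintro ⟨c, x⟩
    obtain ⟨y, rfl⟩ := Submodule.mkQ_surjective _ c
    constructor
    · intro h
      obtain ⟨g, rfl⟩ := (haq y).1 h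
      refine ⟨g + s (x - r g), Prod.ext ?_ ?_⟩
      · refine (Submodule.Quotient.eq N).2 ⟨x - r g, ?_⟩
        simp
      · change r (g + s (x - r g)) = x
        rw [map_add, hrs', add_sub_cancel]
    · rintro ⟨g, hg⟩
      rw [← hg]
      exact hqa g
  · obtain ⟨ψ, hψ⟩ := hext Q hQ hQ' (φ ∘ₗ r)
    refine ⟨ψ, ?_⟩
    rw [← LinearMap.comp_assoc, hψ, LinearMap.comp_assoc, hrs, LinearMap.comp_id]

/-- Dually, `K = Ker (P → G → X)` fits into an exact sequence `0 → K' → K × X → G → 0`. -/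
theorem exists_step_left_of_retract {X G : ModuleCat.{u} A} (hG : IsGproj A G) {s : X →ₗ[A] G}
    {r : G →ₗ[A] X} (hrs : r ∘ₗ s = LinearMap.id) :
    ∃ K : ModuleCat.{u} A, IsGproj A (K × X) ∧ ProjStep K X := by
  obtain ⟨K', hK', P, a, q, h1, h2, ha, hq, haq, hext⟩ := hG.exists_step_left
  have hrs' (x) : r (s x) = x := LinearMap.congr_fun hrs x
  have hqa (x) : q (a x) = 0 := (haq _).2 ⟨x, rfl⟩
  let N := LinearMap.ker (r ∘ₗ q)
  let c : K' →ₗ[A] N := a.codRestrict N fun x => by simp [N, hqa]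
  refine ⟨ModuleCat.of A N, IsGproj.of_exact (X := K') (Y := G)
    (Z := ModuleCat.of A (N × X)) (i := LinearMap.inl A N X ∘ₗ c)
    (p := (q ∘ₗ N.subtype).coprod s) ?_ ?_ ?_ hK' hG,
    P, N.subtype, r ∘ₗ q, h1, h2, Subtype.val_injective,
    (Function.RightInverse.surjective hrs').comp hq, LinearMap.exact_subtype_ker_map _,
    fun Q hQ hQ' φ => ?_⟩
  · intro x y hxy
    exact ha (congrArg (fun z : N × X => z.1.1) hxy)
  · intro g
    obtain ⟨y, hy⟩ := hq (g - s (r g))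
    refine ⟨(⟨y, by simp [N, hy, hrs']⟩, r g), ?_⟩
    change q y + s (r g) = g
    rw [hy, sub_add_cancel]
  · rintro ⟨⟨y, hy⟩, x⟩
    change q y + s x = 0 ↔ _
    constructor
    · intro h
      have hx := congrArg r h
      rw [map_add, hrs', map_zero, show r (q y) = 0 from hy, zero_add] at hx
      subst hx
      rw [map_zero, add_zero] at h
      obtain ⟨k, rfl⟩ := (haq y).1 h
      exact ⟨k, rfl⟩
    · rintro ⟨k, hk⟩
      obtain ⟨hk1, hk2⟩ := Prod.ext_iff.1 hk
      obtain rfl : a k = y := congrArg Subtype.val hk1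
      obtain rfl : 0 = x := hk2
      rw [hqa, map_zero, add_zero]
  · obtain ⟨ψ, hψ⟩ := hext Q hQ hQ' (φ ∘ₗ c)
    let l : N →ₗ[A] LinearMap.ker r := (q ∘ₗ N.subtype).codRestrict _ fun x => x.2
    have hl : Function.Surjective l := by
      rintro ⟨g, hg⟩
      obtain ⟨y, rfl⟩ := hq g
      exact ⟨⟨y, hg⟩, rfl⟩
    obtain ⟨χ, hχ⟩ := exists_comp_eq_of_surjective hl (φ - ψ ∘ₗ N.subtype) (by
      rintro ⟨y, hy⟩ hz
      obtain ⟨k, rfl⟩ := (haq y).1 (congrArg Subtype.val hz)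
      exact sub_eq_zero.2 (LinearMap.congr_fun hψ k).symm)
    -- `Ker r` is a direct summand of `G`, so `χ` extends to `G` by composing with the projection `1
    -- - s r`.
    let e : G →ₗ[A] LinearMap.ker r :=
      (LinearMap.id - s ∘ₗ r).codRestrict _ fun x => by simp [hrs']
    refine ⟨ψ + χ ∘ₗ e ∘ₗ q, ?_⟩
    refine LinearMap.ext fun (z : N) => ?_
    have h4 := LinearMap.congr_fun hχ z
    have h5 : e (q z.1) = l z := Subtype.ext (by
      have : r (q z.1) = 0 := z.2
      change q z.1 - s (r (q z.1)) = q z.1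
      rw [this, map_zero, sub_zero])
    change ψ z.1 + χ (e (q z.1)) = φ z
    rw [h5]
    exact (congrArg _ h4).trans (add_sub_cancel _ _)

/-- Gorenstein-projective modules are closed under direct summands. -/
theorem IsGproj.of_retract {X G : ModuleCat.{u} A} (hG : IsGproj A G) {s : X →ₗ[A] G}
    {r : G →ₗ[A] X} (hrs : r ∘ₗ s = LinearMap.id) : IsGproj A X := by
  refine isGproj_of_class (fun X => ∃ (G : ModuleCat.{u} A) (s : X →ₗ[A] G) (r : G →ₗ[A] X),
    IsGproj A G ∧ r ∘ₗ s = LinearMap.id) ?_ ?_ ⟨G, s, r, hG, hrs⟩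
  · rintro X ⟨G, s, r, hG, hrs⟩
    obtain ⟨C, hC, h⟩ := exists_step_right_of_retract hG hrs
    exact ⟨C, ⟨ModuleCat.of A (C × X), LinearMap.inl A C X, LinearMap.fst A C X, hC, rfl⟩, h⟩
  · rintro X ⟨G, s, r, hG, hrs⟩
    obtain ⟨C, hC, h⟩ := exists_step_left_of_retract hG hrs
    exact ⟨C, ⟨ModuleCat.of A (C × X), LinearMap.inl A C X, LinearMap.fst A C X, hC, rfl⟩, h⟩

theorem IsGproj.prod {X Y : Type u} [AddCommGroup X] [Module A X] [AddCommGroup Y] [Module A Y]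
    (hX : IsGproj A X) (hY : IsGproj A Y) : IsGproj A (X × Y) :=
  IsGproj.of_exact (X := ModuleCat.of A X) (Y := ModuleCat.of A Y) (Z := ModuleCat.of A (X × Y))
    (i := LinearMap.inl A X Y) (p := LinearMap.snd A X Y) LinearMap.inl_injective
    LinearMap.snd_surjective Function.Exact.inl_snd hX hY

theorem IsGproj.pi {n : ℕ} (F : Fin n → ModuleCat.{u} A) (h : ∀ i, IsGproj A (F i)) :
    IsGproj A (∀ i, F i) := by
  induction n with
  | zero =>
    exact isGproj_of_projective (ModuleCat.of A (∀ i, F i))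
      (inferInstanceAs (Module.Finite A (∀ i, F i)))
      (Module.Projective.of_free (R := A) (P := ∀ i, F i))
  | succ n ih =>
    exact ((h 0).prod (ih (fun i => F i.succ) fun i => h i.succ)).of_equiv
      (Fin.consLinearEquiv A fun i => F i).symm

end Gproj

/-! ### Gorenstein-projectives are summands of powers of `E` -/

section Add

variable {A : Type u} [Ring A] (E : Type u) [AddCommGroup E] [Module A E]

/-- The identity of `X` is a finite sum of maps factoring through `E`, i.e. `X` is a direct summand
of a finite direct sum of copies of `E`. -/
def InFinAdd (X : Type u) [AddCommGroup X] [Module A X] : Prop :=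
  ∃ (ι : Type) (_ : Fintype ι) (a : ι → X →ₗ[A] E) (b : ι → E →ₗ[A] X),
    ∑ j, b j ∘ₗ a j = LinearMap.id

variable {E} {X Y Z : Type u} [AddCommGroup X] [Module A X] [AddCommGroup Y] [Module A Y]
  [AddCommGroup Z] [Module A Z]

theorem InFinAdd.of_sum (hX : InFinAdd (A := A) E X) (hY : InFinAdd (A := A) E Y) {i : X →ₗ[A] Z}
    {p : Z →ₗ[A] X} {j : Y →ₗ[A] Z} {q : Z →ₗ[A] Y} (h : i ∘ₗ p + j ∘ₗ q = LinearMap.id) :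
    InFinAdd (A := A) E Z := by
  obtain ⟨ι, _, a, b, hab⟩ := hX
  obtain ⟨κ, _, c, d, hcd⟩ := hY
  refine ⟨ι ⊕ κ, inferInstance, Sum.elim (fun l => a l ∘ₗ p) fun l => c l ∘ₗ q,
    Sum.elim (fun l => i ∘ₗ b l) fun l => j ∘ₗ d l, ?_⟩
  rw [Fintype.sum_sum_type, ← h]
  congr 1
  · ext z
    have := LinearMap.congr_fun hab (p z)
    simp only [LinearMap.sum_apply, LinearMap.comp_apply, LinearMap.id_apply] at this
    simp [← map_sum, this]
  · ext z
    have := LinearMap.congr_fun hcd (q z)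
    simp only [LinearMap.sum_apply, LinearMap.comp_apply, LinearMap.id_apply] at this
    simp [← map_sum, this]

theorem inFinAdd_of_retract {s : X →ₗ[A] E} {r : E →ₗ[A] X} (h : r ∘ₗ s = LinearMap.id) :
    InFinAdd (A := A) E X :=
  ⟨Unit, inferInstance, fun _ => s, fun _ => r, by simpa using h⟩

theorem InFinAdd.sum_apply {ι : Type} [Fintype ι] {a : ι → X →ₗ[A] E} {b : ι → E →ₗ[A] X}
    (h : ∑ j, b j ∘ₗ a j = LinearMap.id) (x : X) : ∑ j, b j (a j x) = x := by
  simpa using LinearMap.congr_fun h x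

/-- Induction on length: a decomposable module splits into two proper summands, which are shorter
and, by `IsGproj.of_retract`, still Gorenstein-projective. -/
theorem IsGprojGenerator.inFinAdd [IsArtinianRing A] (hE : IsGprojGenerator A E)
    {X : ModuleCat.{u} A} (hX : IsGproj A X) : InFinAdd (A := A) E X := by
  classical
  obtain ⟨n, F, ⟨-, -, hF⟩, ⟨e⟩⟩ := hE
  have key : ∀ (l : ℕ∞) (X : ModuleCat.{u} A), IsGproj A X → Module.length A X = l →
      InFinAdd (A := A) E X := by
    intro l
    induction l using WellFoundedLT.induction with
    | ind l ih =>
    intro X hX hl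
    have hfin : Module.Finite A X := hX.1
    by_cases hi : IsIndecomposable A X
    · obtain ⟨i, ⟨f⟩⟩ := hF X hX hi
      refine inFinAdd_of_retract (s := e.symm.toLinearMap ∘ₗ LinearMap.single A _ i ∘ₗ f.toLinearMap)
        (r := f.symm.toLinearMap ∘ₗ LinearMap.proj i ∘ₗ e.toLinearMap) ?_
      ext x
      simp
    · by_cases hn : Nontrivial X
      · simp only [IsIndecomposable, hn, true_and, not_forall, not_or] at hi
        obtain ⟨p, q, hpq, hp, hq⟩ := hi
        have hp' : p ≠ ⊤ := fun h => hq (by simpa [h] using hpq.inf_eq_bot)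
        have hq' : q ≠ ⊤ := fun h => hp (by simpa [h] using hpq.inf_eq_bot)
        have h1 := ih _ (hl ▸ Submodule.length_lt hp') (ModuleCat.of A p)
          (hX.of_retract (s := p.subtype) (r := p.projectionOnto q hpq) (by ext x; simp)) rfl
        have h2 := ih _ (hl ▸ Submodule.length_lt hq') (ModuleCat.of A q)
          (hX.of_retract (s := q.subtype) (r := q.projectionOnto p hpq.symm) (by ext x; simp)) rfl
        refine h1.of_sum h2 (i := p.subtype) (p := p.projectionOnto q hpq) (j := q.subtype)
          (q := q.projectionOnto p hpq.symm) ?_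
        ext x
        exact Submodule.projection_add_projection_eq_self hpq x
      · rw [not_nontrivial_iff_subsingleton] at hn
        exact ⟨Empty, inferInstance, fun x => x.elim, fun x => x.elim,
          LinearMap.ext fun x => Subsingleton.elim _ _⟩
  exact key _ X hX rfl

theorem IsGprojGenerator.isGproj (hE : IsGprojGenerator A E) : IsGproj A E := by
  obtain ⟨n, F, hF, ⟨e⟩⟩ := hE
  exact (IsGproj.pi F fun i => (hF.1 i).1).of_equiv e

/-- Properness need only be tested on `E`: a map `g` from `X` equals `∑ (g ∘ b j) ∘ a j`, and each
`g ∘ b j` starts at `E`. -/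
theorem InFinAdd.hom_surjective (hX : InFinAdd (A := A) E X) {p : Y →ₗ[A] Z}
    (h : Function.Surjective fun g : E →ₗ[A] Y => p ∘ₗ g) :
    Function.Surjective fun g : X →ₗ[A] Y => p ∘ₗ g := by
  obtain ⟨ι, _, a, b, hab⟩ := hX
  intro g
  choose c hc using fun j => h (g ∘ₗ b j)
  refine ⟨∑ j, c j ∘ₗ a j, ?_⟩
  ext x
  have hc' (j) (y : E) : p (c j y) = g (b j y) := LinearMap.congr_fun (hc j) y
  simp only [LinearMap.comp_apply, LinearMap.sum_apply, map_sum, hc']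
  rw [← map_sum, InFinAdd.sum_apply hab]

end Add

/-! ### Existence of minimal proper presentations -/

section Existence

variable {A : Type u} [Ring A]

/-- An approximation `p` of least length is right minimal. If `p φ = p`, Fitting's lemma makes the
image of a high power of `φ` a direct summand, and `p` restricted to it is still an approximation;
by minimality the image is everything. -/
theorem exists_minimal_approximation [IsArtinianRing A] (𝒳 : ModuleCat.{u} A → Prop)
    (hfin : ∀ X, 𝒳 X → Module.Finite A X)
    (hret : ∀ {X G : ModuleCat.{u} A} {s : X →ₗ[A] G} {r : G →ₗ[A] X}, 𝒳 G →
      r ∘ₗ s = LinearMap.id → 𝒳 X)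
    {M : Type u} [AddCommGroup M] [Module A M] {X : ModuleCat.{u} A} (hX : 𝒳 X) (p : X →ₗ[A] M)
    (hp : ∀ G : ModuleCat.{u} A, 𝒳 G → Function.Surjective fun h : G →ₗ[A] X => p ∘ₗ h) :
    ∃ (X : ModuleCat.{u} A) (p : X →ₗ[A] M), 𝒳 X ∧ RightMinimal p ∧
      ∀ G : ModuleCat.{u} A, 𝒳 G → Function.Surjective fun h : G →ₗ[A] X => p ∘ₗ h := by
  let S : Set ℕ∞ := {l | ∃ (X : ModuleCat.{u} A) (p : X →ₗ[A] M), 𝒳 X ∧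
    (∀ G : ModuleCat.{u} A, 𝒳 G → Function.Surjective fun h : G →ₗ[A] X => p ∘ₗ h) ∧
    Module.length A X = l}
  have hS : S.Nonempty := ⟨_, X, p, hX, hp, rfl⟩
  clear hp p hX X
  obtain ⟨P, p, hP, hs, hl⟩ := wellFounded_lt.min_mem S hS
  have := hfin P hP
  refine ⟨P, p, hP, fun φ hφ => ?_, hs⟩
  have hpow : ∀ n, p ∘ₗ (φ ^ n : Module.End A P) = p := by
    intro n
    induction n with
    | zero => ext; simp
    | succ n ih =>
      rw [pow_succ, Module.End.mul_eq_comp, ← LinearMap.comp_assoc, ih, hφ]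
  obtain ⟨n, hn⟩ := Filter.eventually_atTop.1 (LinearMap.eventually_isCompl_ker_pow_range_pow φ)
  -- The exponent `n + 1` is positive even for `n = 0`, so surjectivity of the power forces that of
  -- `φ`.
  have hc := hn (n + 1) (Nat.le_succ n)
  set Q := LinearMap.range (φ ^ (n + 1) : Module.End A P) with hQ
  have htop : Q = ⊤ := by
    by_contra hne
    have hlt := Submodule.length_lt (R := A) hne
    have hmem : Module.length A Q ∈ S := by
      refine ⟨ModuleCat.of A Q, p ∘ₗ Q.subtype,
        hret (s := Q.subtype) (r := Q.projectionOnto _ hc.symm) hP (by ext x; simp), ?_, rfl⟩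
      intro G hG g
      obtain ⟨h, rfl⟩ := hs G hG g
      exact ⟨(φ ^ (n + 1) : Module.End A P).rangeRestrict ∘ₗ h,
        congrArg (· ∘ₗ h) (hpow (n + 1))⟩
    rw [hl] at hlt
    exact wellFounded_lt.not_lt_min S hmem hlt
  have hsurj : Function.Surjective φ := by
    intro y
    have hy : y ∈ Q := htop ▸ Submodule.mem_top
    obtain ⟨x, hx⟩ := hy
    exact ⟨(φ ^ n : Module.End A P) x, by rw [← hx, pow_succ', Module.End.mul_apply]⟩
  exact ⟨IsNoetherian.injective_of_surjective_endomorphism φ hsurj, hsurj⟩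

variable {E : Type u} [AddCommGroup E] [Module A E]

theorem IsGprojGenerator.exists_minimal_approximation [IsArtinianRing A]
    (hE : IsGprojGenerator A E) (M : Type u) [AddCommGroup M] [Module A M]
    [Module.Finite (CMAuslander A E) (E →ₗ[A] M)] :
    ∃ (X : ModuleCat.{u} A) (p : X →ₗ[A] M), IsGproj A X ∧ RightMinimal p ∧
      Function.Surjective p ∧
      ∀ G : ModuleCat.{u} A, IsGproj A G → Function.Surjective fun h : G →ₗ[A] X => p ∘ₗ h := by
  -- Generators `v` of `Hom_A(E, M)` over `Γ` assemble to `E^n → M`, through which every map `E → M`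
  -- factors.
  obtain ⟨n, v, hv⟩ := Module.Finite.exists_fin (R := CMAuslander A E) (M := E →ₗ[A] M)
  have hEn : IsGproj A (ModuleCat.of A (Fin n → E)) :=
    IsGproj.pi (fun _ => ModuleCat.of A E) fun _ => hE.isGproj
  obtain ⟨X, p, hX, hm, hp⟩ := RelAR.exists_minimal_approximation (fun X => IsGproj A X)
    (fun X hX => hX.1) (fun hG h => hG.of_retract h) (M := M) hEn (LinearMap.lsum A _ ℕ v)
    (fun G hG => (hE.inFinAdd hG).hom_surjective fun g => by
      obtain ⟨c, hc⟩ := (Submodule.mem_span_range_iff_exists_fun _).1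
        (hv ▸ Submodule.mem_top : g ∈ Submodule.span (CMAuslander A E) (Set.range v))
      refine ⟨LinearMap.pi fun i => (c i).unop, ?_⟩
      rw [← hc]
      ext x
      simp only [LinearMap.comp_apply, LinearMap.lsum_apply, LinearMap.sum_apply,
        LinearMap.proj_apply, LinearMap.pi_apply]
      rfl)
  refine ⟨X, p, hX, hm, fun m => ?_, hp⟩
  -- `A` itself is Gorenstein-projective, so approximations are surjective.
  obtain ⟨h, hh⟩ := hp (ModuleCat.of A A) (isGproj_of_projective _
    (inferInstanceAs (Module.Finite A A)) (inferInstanceAs (Module.Projective A A)))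
    (LinearMap.toSpanSingleton A M m)
  have := LinearMap.congr_fun hh (1 : A)
  exact ⟨h (1 : A), this.trans (one_smul A m)⟩

theorem IsGprojGenerator.nonempty_minimalGprojPresentation [IsArtinianRing A]
    (hE : IsGprojGenerator A E) (hfin : ∀ (M : Type u) [AddCommGroup M] [Module A M],
      Module.Finite A M → Module.Finite (CMAuslander A E) (E →ₗ[A] M))
    (M : Type u) [AddCommGroup M] [Module A M] [Module.Finite A M] :
    Nonempty (MinimalGprojPresentation A M) := by
  have := hfin M inferInstance
  obtain ⟨X₀, p, h0, hm, hs, hp⟩ := hE.exists_minimal_approximation M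
  have : Module.Finite A X₀ := h0.1
  have := hfin (LinearMap.ker p) inferInstance
  obtain ⟨X₁, q, h1, hm', hs', hq⟩ := hE.exists_minimal_approximation (LinearMap.ker p)
  refine ⟨⟨X₁, X₀, (LinearMap.ker p).subtype ∘ₗ q, p, h1, h0, ?_, hs, ?_, hp, ?_, hm⟩⟩
  · intro x
    constructor
    · intro hx
      obtain ⟨y, hy⟩ := hs' ⟨x, hx⟩
      exact ⟨y, by simp [hy]⟩
    · rintro ⟨y, rfl⟩
      exact (q y).2
  · intro X hX g
    constructor
    · intro hg
      obtain ⟨h, hh⟩ := hq X hX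
        (g.codRestrict (LinearMap.ker p) (fun x => LinearMap.congr_fun hg x))
      refine ⟨h, ?_⟩
      ext x
      exact congrArg Subtype.val (LinearMap.congr_fun hh x)
    · rintro ⟨h, rfl⟩
      ext x
      exact (q (h x)).2
  · intro φ hφ
    refine hm' φ ?_
    ext x
    have hx := congrArg Subtype.val (LinearMap.congr_fun hφ x)
    exact hx

end Existence

/-! ### Uniqueness of minimal presentations -/

section Uniqueness

variable {R : Type u} [Ring R] {𝒳 : ModuleCat.{u} R → Prop}
  {M : Type u} [AddCommGroup M] [Module R M]

theorem MinimalPresentation.bijective₀ (P : MinimalPresentation 𝒳 M) {φ : P.X₀ →ₗ[R] P.X₀}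
    (h : P.π ∘ₗ φ = P.π) : Function.Bijective φ :=
  P.minimal₀ φ h

theorem MinimalPresentation.bijective₁ (P : MinimalPresentation 𝒳 M) {φ : P.X₁ →ₗ[R] P.X₁}
    (h : P.f ∘ₗ φ = P.f) : Function.Bijective φ :=
  P.minimal₁ φ (LinearMap.ext fun x => Subtype.ext (LinearMap.congr_fun h x))

/-- Minimal presentations are unique up to isomorphism. -/
theorem MinimalPresentation.exists_equiv (P P' : MinimalPresentation 𝒳 M) :
    ∃ (e₁ : P.X₁ ≃ₗ[R] P'.X₁) (e₀ : P.X₀ ≃ₗ[R] P'.X₀),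
      e₀.toLinearMap ∘ₗ P.f = P'.f ∘ₗ e₁.toLinearMap := by
  obtain ⟨u, hu⟩ := P'.hom_surjective P.X₀ P.mem₀ P.π
  obtain ⟨v, hv⟩ := P.hom_surjective P'.X₀ P'.mem₀ P'.π
  simp only at hu hv
  have h1 := P.bijective₀ (φ := v ∘ₗ u) (by rw [← LinearMap.comp_assoc, hv, hu])
  have h2 := P'.bijective₀ (φ := u ∘ₗ v) (by rw [← LinearMap.comp_assoc, hu, hv])
  let e₀ := LinearEquiv.ofBijective u ⟨Function.Injective.of_comp (f := v) h1.1,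
    Function.Surjective.of_comp (g := v) h2.2⟩
  have he : P'.π ∘ₗ e₀.toLinearMap = P.π := hu
  have he' : P.π ∘ₗ e₀.symm.toLinearMap = P'.π := by
    rw [← he, LinearMap.comp_assoc, LinearEquiv.comp_symm, LinearMap.comp_id]
  obtain ⟨w, hw⟩ := (P'.hom_exact P.X₁ P.mem₁ (e₀.toLinearMap ∘ₗ P.f)).1 (by
    change P'.π ∘ₗ _ = 0
    rw [← LinearMap.comp_assoc, he]
    exact P.exact.linearMap_comp_eq_zero)
  obtain ⟨w', hw'⟩ := (P.hom_exact P'.X₁ P'.mem₁ (e₀.symm.toLinearMap ∘ₗ P'.f)).1 (by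
    change P.π ∘ₗ _ = 0
    rw [← LinearMap.comp_assoc, he']
    exact P'.exact.linearMap_comp_eq_zero)
  simp only at hw hw'
  have h3 := P.bijective₁ (φ := w' ∘ₗ w) (by
    rw [← LinearMap.comp_assoc, hw', LinearMap.comp_assoc, hw, ← LinearMap.comp_assoc,
      LinearEquiv.symm_comp, LinearMap.id_comp])
  have h4 := P'.bijective₁ (φ := w ∘ₗ w') (by
    rw [← LinearMap.comp_assoc, hw, LinearMap.comp_assoc, hw', ← LinearMap.comp_assoc,
      LinearEquiv.comp_symm, LinearMap.id_comp])
  exact ⟨LinearEquiv.ofBijective w ⟨Function.Injective.of_comp (f := w') h3.1,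
    Function.Surjective.of_comp (g := w') h4.2⟩, e₀, hw.symm⟩

end Uniqueness

/-! ### Isomorphisms of kernels and of their dual versions -/

section Kernels

variable {R : Type*} [Ring R] {X X' Y Y' : Type*} [AddCommGroup X] [Module R X]
  [AddCommGroup X'] [Module R X'] [AddCommGroup Y] [Module R Y] [AddCommGroup Y'] [Module R Y']

theorem nonempty_ker_equiv {f : X →ₗ[R] Y} {f' : X' →ₗ[R] Y'} (e : X →ₗ[R] X') (l : Y →ₗ[R] Y')
    (he : Function.Bijective e) (hl : Function.Injective l) (h : ∀ x, l (f x) = f' (e x)) :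
    Nonempty (LinearMap.ker f ≃ₗ[R] LinearMap.ker f') := by
  refine ⟨LinearEquiv.ofBijective ((e ∘ₗ (LinearMap.ker f).subtype).codRestrict _ ?_) ⟨?_, ?_⟩⟩
  · rintro ⟨x, hx⟩
    rw [LinearMap.mem_ker]
    change f' (e x) = 0
    rw [← h, hx, map_zero]
  · intro x y hxy
    exact Subtype.ext (he.1 (congrArg Subtype.val hxy))
  · rintro ⟨y, hy⟩
    obtain ⟨x, rfl⟩ := he.2 y
    exact ⟨⟨x, hl ((h x).trans (hy.trans (map_zero l).symm))⟩, rfl⟩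

end Kernels

section DualFunctor

variable (k : Type u) {A : Type u} (W : Type u) [Field k] [Ring A] [Algebra k A]
  [AddCommGroup W] [Module k W] [Module A W] [IsScalarTower k A W]
  (Γ : Type u) [Ring Γ] [Module Γᵐᵒᵖ W] [SMulCommClass A Γᵐᵒᵖ W] [SMulCommClass k Γᵐᵒᵖ W]

theorem DHom.map_map {X Y Z : Type u} [AddCommGroup X] [Module A X] [AddCommGroup Y] [Module A Y]
    [AddCommGroup Z] [Module A Z] (g : Y →ₗ[A] Z) (f : X →ₗ[A] Y) (x : DHom k A W X) :
    DHom.map k W Γ g (DHom.map k W Γ f x) = DHom.map k W Γ (g ∘ₗ f) x :=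
  rfl

theorem DHom.map_bijective {X Y : Type u} [AddCommGroup X] [Module A X] [AddCommGroup Y]
    [Module A Y] (e : X ≃ₗ[A] Y) : Function.Bijective (DHom.map k W Γ e.toLinearMap) := by
  refine Function.bijective_iff_has_inverse.2 ⟨DHom.map k W Γ e.symm.toLinearMap, fun x => ?_,
    fun x => ?_⟩
  · rw [DHom.map_map, LinearEquiv.symm_comp]
    rfl
  · rw [DHom.map_map, LinearEquiv.comp_symm]
    rfl

theorem nonempty_dualKernel_equiv {X₁ X₀ Y₁ Y₀ : Type u} [AddCommGroup X₁] [Module A X₁]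
    [AddCommGroup X₀] [Module A X₀] [AddCommGroup Y₁] [Module A Y₁] [AddCommGroup Y₀] [Module A Y₀]
    {f : X₁ →ₗ[A] X₀} {g : Y₁ →ₗ[A] Y₀} (e₁ : X₁ ≃ₗ[A] Y₁) (e₀ : X₀ ≃ₗ[A] Y₀)
    (h : e₀.toLinearMap ∘ₗ f = g ∘ₗ e₁.toLinearMap) :
    Nonempty (dualKernel k W Γ f ≃ₗ[Γ] dualKernel k W Γ g) :=
  nonempty_ker_equiv _ _ (DHom.map_bijective k W Γ e₁) (DHom.map_bijective k W Γ e₀).1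
    fun x => by rw [DHom.map_map, DHom.map_map, h]

end DualFunctor

/-! ### The functor `Hom_A(E, -)` and projective `Γ`-modules -/

section Yoneda

variable {A : Type u} [Ring A] (E : Type u) [AddCommGroup E] [Module A E]
  {X Y M : Type u} [AddCommGroup X] [Module A X] [AddCommGroup Y] [Module A Y]
  [AddCommGroup M] [Module A M]

/-- The map `Hom_A(E, X) → Hom_A(E, M)` induced by `g : X → M`. -/
def homMap (g : X →ₗ[A] M) : (E →ₗ[A] X) →ₗ[CMAuslander A E] (E →ₗ[A] M) where
  toFun h := g ∘ₗ h
  map_add' h h' := LinearMap.comp_add h h' g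
  map_smul' _ _ := rfl

@[simp] theorem homMap_apply (g : X →ₗ[A] M) (h : E →ₗ[A] X) : homMap E g h = g ∘ₗ h := rfl

theorem CMAuslander.smul_def (s : CMAuslander A E) (h : E →ₗ[A] X) : s • h = h ∘ₗ s.unop := rfl

variable {E}

theorem InFinAdd.homMap_injective (hX : InFinAdd (A := A) E X) :
    Function.Injective (homMap E : (X →ₗ[A] M) → _) := by
  obtain ⟨ι, _, a, b, hab⟩ := hX
  intro g g' h
  ext x
  have h' (j) (y : E) : g (b j y) = g' (b j y) :=
    LinearMap.congr_fun (LinearMap.congr_fun h (b j)) y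
  rw [← InFinAdd.sum_apply hab x, map_sum, map_sum]
  exact Finset.sum_congr rfl fun j _ => h' j _

/-- The maps `b j` generate `Hom_A(E, X)` over `Γ`, since `h = ∑ (a j ∘ h) • b j`; hence `φ` is
determined by the values `φ (b j)`, and `∑ φ (b j) ∘ a j` induces it. -/
theorem InFinAdd.homMap_surjective (hX : InFinAdd (A := A) E X) :
    Function.Surjective (homMap E : (X →ₗ[A] M) → _) := by
  obtain ⟨ι, _, a, b, hab⟩ := hX
  intro φ
  refine ⟨∑ j, φ (b j) ∘ₗ a j, ?_⟩
  refine LinearMap.ext fun h => ?_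
  have key : h = ∑ j, (MulOpposite.op (a j ∘ₗ h) : CMAuslander A E) • b j := by
    ext x
    simp only [CMAuslander.smul_def, LinearMap.sum_apply, LinearMap.comp_apply,
      MulOpposite.unop_op]
    exact (InFinAdd.sum_apply hab (h x)).symm
  conv_rhs => rw [key, map_sum]
  simp only [map_smul]
  ext x
  simp only [CMAuslander.smul_def, LinearMap.sum_apply, LinearMap.comp_apply,
    MulOpposite.unop_op, homMap_apply]

theorem InFinAdd.finite_projective_hom (hX : InFinAdd (A := A) E X) :
    Module.Finite (CMAuslander A E) (E →ₗ[A] X) ∧ Module.Projective (CMAuslander A E) (E →ₗ[A] X) := by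
  obtain ⟨ι, _, a, b, hab⟩ := hX
  let s : (E →ₗ[A] X) →ₗ[CMAuslander A E] (ι → CMAuslander A E) :=
    -- The families `a` and `b` act as a dual basis of `Hom_A(E, X)`.
    { toFun := fun h j => MulOpposite.op (a j ∘ₗ h)
      map_add' := fun h h' => funext fun j =>
        congrArg MulOpposite.op (LinearMap.comp_add h h' (a j))
      map_smul' := fun _ _ => rfl }
  let r : (ι → CMAuslander A E) →ₗ[CMAuslander A E] (E →ₗ[A] X) :=
    Fintype.linearCombination (CMAuslander A E) b
  have hrs : r ∘ₗ s = LinearMap.id := by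
    refine LinearMap.ext fun h => ?_
    ext x
    simp only [r, s, LinearMap.comp_apply, Fintype.linearCombination_apply, LinearMap.coe_mk,
      AddHom.coe_mk, CMAuslander.smul_def, LinearMap.sum_apply, MulOpposite.unop_op]
    exact InFinAdd.sum_apply hab (h x)
  exact ⟨Module.Finite.of_surjective r
    (Function.RightInverse.surjective fun h => LinearMap.congr_fun hrs h),
    Module.Projective.of_split s r hrs⟩

theorem homMap_bijective_of_bijective {g : X →ₗ[A] M} (hg : Function.Bijective g) :
    Function.Bijective (homMap E g) := by
  let e := LinearEquiv.ofBijective g hg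
  refine ⟨fun h h' hh => LinearMap.ext fun x => hg.1 (LinearMap.congr_fun hh x), fun h =>
    ⟨e.symm.toLinearMap ∘ₗ h, LinearMap.ext fun x => e.apply_symm_apply (h x)⟩⟩

/-- Applying `Hom_A(E, -)` gives a projective presentation by properness. It is minimal because each
endomorphism of `Hom_A(E, X)`, for `X` in `add E`, is induced by a unique endomorphism of `X`. -/
theorem MinimalPresentation.exists_projective_hom (hE : IsGproj A E)
    (hadd : ∀ X : ModuleCat.{u} A, IsGproj A X → InFinAdd (A := A) E X)
    (P : MinimalGprojPresentation A M) :
    ∃ P' : MinimalProjPresentation (CMAuslander A E) (E →ₗ[A] M),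
      ∃ (e₁ : (E →ₗ[A] P.X₁) ≃ₗ[CMAuslander A E] P'.X₁)
        (e₀ : (E →ₗ[A] P.X₀) ≃ₗ[CMAuslander A E] P'.X₀),
        e₀.toLinearMap ∘ₗ homMap E P.f = P'.f ∘ₗ e₁.toLinearMap := by
  have hf : Function.Exact (homMap E P.f) (homMap E P.π) := P.hom_exact (ModuleCat.of A E) hE
  have hs : Function.Surjective (homMap E P.π) := P.hom_surjective (ModuleCat.of A E) hE
  refine ⟨{
    X₁ := ModuleCat.of _ (E →ₗ[A] P.X₁)
    X₀ := ModuleCat.of _ (E →ₗ[A] P.X₀)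
    f := homMap E P.f
    π := homMap E P.π
    mem₁ := (hadd _ P.mem₁).finite_projective_hom
    mem₀ := (hadd _ P.mem₀).finite_projective_hom
    exact := hf
    surjective := hs
    hom_exact := fun X hX g => ?_
    hom_surjective := fun X hX g => ?_
    minimal₁ := fun φ hφ => ?_
    minimal₀ := fun φ hφ => ?_ }, LinearEquiv.refl _ _, LinearEquiv.refl _ _, rfl⟩
  · have := hX.2
    constructor
    · intro hg
      obtain ⟨h, hh⟩ := Module.projective_lifting_property (homMap E P.f).rangeRestrict
        (g.codRestrict (LinearMap.range (homMap E P.f))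
          fun x => (hf _).1 (LinearMap.congr_fun hg x)) (LinearMap.surjective_rangeRestrict _)
      exact ⟨h, LinearMap.ext fun x => congrArg Subtype.val (LinearMap.congr_fun hh x)⟩
    · rintro ⟨h, rfl⟩
      exact LinearMap.ext fun x => (hf _).2 ⟨h x, rfl⟩
  · have := hX.2
    exact Module.projective_lifting_property _ g hs
  · obtain ⟨ψ, rfl⟩ := (hadd _ P.mem₁).homMap_surjective φ
    have hψ := P.bijective₁ (φ := ψ) ((hadd _ P.mem₁).homMap_injective (LinearMap.ext fun x =>
      congrArg Subtype.val (LinearMap.congr_fun hφ x)))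
    exact (homMap_bijective_of_bijective hψ)
  · obtain ⟨ψ, rfl⟩ := (hadd _ P.mem₀).homMap_surjective φ
    have hψ := P.bijective₀ (φ := ψ) ((hadd _ P.mem₀).homMap_injective hφ)
    exact (homMap_bijective_of_bijective hψ)

end Yoneda

/-! ### Comparison of `τ_G M` with `τ Hom_A(E, M)` -/

section Comparison

variable (k : Type u) {A : Type u} (E : Type u) [Field k] [Ring A] [Algebra k A]
  [AddCommGroup E] [Module k E] [Module A E] [IsScalarTower k A E]
  {X Y : Type u} [AddCommGroup X] [Module A X] [AddCommGroup Y] [Module A Y]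

variable (X) in
/-- The map `Hom_A(X, E) → Hom_Γ(Hom_A(E, X), Γ)` given by the functor `Hom_A(E, -)`. -/
def homDual : (X →ₗ[A] E) →ₗ[k] ((E →ₗ[A] X) →ₗ[CMAuslander A E] CMAuslander A E) where
  toFun g :=
    { toFun := fun h => MulOpposite.op (g ∘ₗ h)
      map_add' := fun h h' => congrArg MulOpposite.op (LinearMap.comp_add h h' g)
      map_smul' := fun _ _ => rfl }
  map_add' _ _ := rfl
  map_smul' _ _ := rfl

/-- Full faithfulness of `Hom_A(E, -)` on maps `X → E`, once `End_A(E)` is read as the left regular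
module `Γ`. -/
theorem InFinAdd.homDual_bijective (hX : InFinAdd (A := A) E X) :
    Function.Bijective (homDual k (A := A) E X) := by
  let e : (E →ₗ[A] E) ≃ₗ[CMAuslander A E] CMAuslander A E :=
    { MulOpposite.opAddEquiv with map_smul' := fun _ _ => rfl }
  constructor
  · intro g g' h
    refine hX.homMap_injective (LinearMap.ext fun x => ?_)
    exact MulOpposite.op_injective (LinearMap.congr_fun h x)
  · intro φ
    obtain ⟨g, hg⟩ := hX.homMap_surjective (e.symm.toLinearMap ∘ₗ φ)
    refine ⟨g, LinearMap.ext fun h => ?_⟩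
    have := LinearMap.congr_fun hg h
    exact congrArg MulOpposite.op this

variable (X) in
/-- The map `D Hom_Γ(Hom_A(E, X), Γ) → D Hom_A(X, E)` given by the functor `Hom_A(E, -)`. -/
def dualHomDual :
    DHom k (CMAuslander A E) (CMAuslander A E) (E →ₗ[A] X) →ₗ[CMAuslander A E] DHom k A E X where
  toFun μ := LinearMap.comp (show Module.Dual k _ from μ) (homDual k E X)
  map_add' _ _ := rfl
  map_smul' _ _ := rfl

theorem InFinAdd.dualHomDual_bijective (hX : InFinAdd (A := A) E X) :
    Function.Bijective (dualHomDual k (A := A) E X) := by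
  let e := LinearEquiv.ofBijective _ (hX.homDual_bijective k)
  exact e.dualMap.bijective

theorem dualHomDual_naturality (f : X →ₗ[A] Y)
    (μ : DHom k (CMAuslander A E) (CMAuslander A E) (E →ₗ[A] X)) :
    dualHomDual k E Y (DHom.map k _ (CMAuslander A E) (homMap E f) μ) =
      DHom.map k E (CMAuslander A E) f (dualHomDual k E X μ) :=
  rfl

theorem nonempty_tauG_equiv_tau [Module.Finite k A] [Module.Finite A E] (hE : IsGproj A E)
    (hadd : ∀ X : ModuleCat.{u} A, IsGproj A X → InFinAdd (A := A) E X)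
    {M : Type u} [AddCommGroup M] [Module A M] [Module.Finite (CMAuslander A E) (E →ₗ[A] M)]
    (P : MinimalGprojPresentation A M) :
    Nonempty (tauG k E P ≃ₗ[CMAuslander A E] tau k (CMAuslander A E) (E →ₗ[A] M)) := by
  obtain ⟨P', e₁, e₀, h⟩ := P.exists_projective_hom hE hadd
  -- `tau` is defined by a chosen presentation; uniqueness compares it with the one coming from `P`.
  obtain ⟨e₁', e₀', h'⟩ := P'.exists_equiv (minimalProjPresentation k (CMAuslander A E) (E →ₗ[A] M))
  obtain ⟨i₁⟩ := nonempty_dualKernel_equiv k (CMAuslander A E) (CMAuslander A E) e₁ e₀ h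
  obtain ⟨i₂⟩ := nonempty_dualKernel_equiv k (CMAuslander A E) (CMAuslander A E) e₁' e₀' h'
  obtain ⟨i₃⟩ := nonempty_ker_equiv _ _ ((hadd _ P.mem₁).dualHomDual_bijective k)
    ((hadd _ P.mem₀).dualHomDual_bijective k).1 (dualHomDual_naturality k E P.f)
  exact ⟨i₃.symm.trans (i₁.trans i₂)⟩

end Comparison

/-! ### The duality `D Hom_A(X, M) ≅ Hom_Γ(Hom_A(E, M), D Hom_A(X, E))` -/

section Pairing

variable (k : Type u) {A : Type u} (E : Type u) [Field k] [Ring A] [Algebra k A]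
  [AddCommGroup E] [Module k E] [Module A E] [IsScalarTower k A E]
  (X Y M : Type u) [AddCommGroup X] [Module A X] [AddCommGroup Y] [Module A Y]
  [AddCommGroup M] [Module k M] [Module A M] [IsScalarTower k A M]

/-- Precomposition with `f` as a `k`-linear map. -/
def precomp {X Y : Type u} [AddCommGroup X] [Module A X] [AddCommGroup Y] [Module A Y]
    (f : X →ₗ[A] Y) : (Y →ₗ[A] M) →ₗ[k] (X →ₗ[A] M) where
  toFun h := h ∘ₗ f
  map_add' _ _ := rfl
  map_smul' _ _ := rfl

/-- The map `D Hom_A(X, M) → Hom_Γ(Hom_A(E, M), D Hom_A(X, E))` that sends `μ` to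
`h ↦ g ↦ μ (h g)`. -/
def dualPairing (μ : Module.Dual k (X →ₗ[A] M)) :
    (E →ₗ[A] M) →ₗ[CMAuslander A E] DHom k A E X where
  toFun h := (μ ∘ₗ
    { toFun := fun g => h ∘ₗ g
      map_add' := fun g g' => LinearMap.comp_add g g' h
      map_smul' := fun c g => LinearMap.ext fun x => by
        change h (c • g x) = c • h (g x)
        rw [← algebraMap_smul A c (g x), map_smul, algebraMap_smul] } :
    Module.Dual k (X →ₗ[A] E))
  map_add' h h' := LinearMap.ext fun g => (congrArg μ (LinearMap.add_comp g h' h)).trans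
    (map_add μ _ _)
  map_smul' _ _ := rfl

variable {X Y M}

/-- Evaluation of an element of `D Hom_A(X, E)`. -/
def DHom.eval (g : X →ₗ[A] E) : DHom k A E X →+ k where
  toFun μ := (show Module.Dual k (X →ₗ[A] E) from μ) g
  map_zero' := rfl
  map_add' _ _ := rfl

variable {E} in
theorem InFinAdd.dualPairing_injective (hX : InFinAdd (A := A) E X) :
    Function.Injective (dualPairing k (A := A) E X M) := by
  obtain ⟨ι, _, a, b, hab⟩ := hX
  intro μ ν h
  ext u
  have hu : u = ∑ j, (u ∘ₗ b j) ∘ₗ a j := by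
    ext x
    simp only [LinearMap.sum_apply, LinearMap.comp_apply]
    rw [← map_sum, InFinAdd.sum_apply hab]
  rw [hu, map_sum, map_sum]
  refine Finset.sum_congr rfl fun j _ => ?_
  exact congrArg (DHom.eval k E (a j)) (LinearMap.congr_fun h (u ∘ₗ b j))

variable {E} in
theorem InFinAdd.dualPairing_surjective (hX : InFinAdd (A := A) E X) :
    Function.Surjective (dualPairing k (A := A) E X M) := by
  obtain ⟨ι, _, a, b, hab⟩ := hX
  intro φ
  have hev (s : CMAuslander A E) (h : E →ₗ[A] M) (g : X →ₗ[A] E) :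
      DHom.eval k E g (φ (s • h)) = DHom.eval k E (s.unop ∘ₗ g) (φ h) := by
    rw [map_smul]
    rfl
  -- Scalars of `k` act on `Hom_A(E, M)` through `Γ`, so a `Γ`-linear `φ` is `k`-linear too; this
  -- makes `μ` linear.
  have hsmul (c : k) (h : E →ₗ[A] M) :
      c • h = (MulOpposite.op (c • LinearMap.id) : CMAuslander A E) • h := by
    ext x
    change c • h x = h (c • x)
    rw [← algebraMap_smul A c x, map_smul, algebraMap_smul]
  -- Forced by `u = ∑ (u ∘ b j) ∘ a j`.
  let μ : Module.Dual k (X →ₗ[A] M) :=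
    { toFun := fun u => ∑ j, DHom.eval k E (a j) (φ (u ∘ₗ b j))
      map_add' := fun u v => by
        simp only [LinearMap.add_comp, map_add, Finset.sum_add_distrib]
      map_smul' := fun c u => by
        rw [RingHom.id_apply, Finset.smul_sum]
        refine Finset.sum_congr rfl fun j _ => ?_
        rw [LinearMap.smul_comp, hsmul, hev]
        exact map_smul (show Module.Dual k (X →ₗ[A] E) from φ (u ∘ₗ b j)) c (a j) }
  refine ⟨μ, LinearMap.ext fun h => LinearMap.ext fun g => ?_⟩
  change ∑ j, DHom.eval k E (a j) (φ (h ∘ₗ g ∘ₗ b j)) = DHom.eval k E g (φ h)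
  have h1 (j) : DHom.eval k E (a j) (φ (h ∘ₗ g ∘ₗ b j)) =
      (show Module.Dual k (X →ₗ[A] E) from φ h) ((g ∘ₗ b j) ∘ₗ a j) :=
    hev (MulOpposite.op (g ∘ₗ b j)) h (a j)
  rw [Finset.sum_congr rfl fun j _ => h1 j, ← map_sum]
  refine congrArg (show Module.Dual k (X →ₗ[A] E) from φ h) ?_
  ext x
  simp only [LinearMap.sum_apply, LinearMap.comp_apply]
  rw [← map_sum, InFinAdd.sum_apply hab]

theorem map_dualPairing (f : X →ₗ[A] Y) (μ : Module.Dual k (X →ₗ[A] M)) (h : E →ₗ[A] M) :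
    DHom.map k E (CMAuslander A E) f (dualPairing k E X M μ h) =
      dualPairing k E Y M (μ ∘ₗ precomp k M f) h :=
  rfl

variable {E} in
-- Under the pairing, maps into the kernel correspond to functionals `μ` on `Hom_A(X, M)` vanishing
-- on the image of `Hom_A(f, M)`; over a field these are all zero exactly when that image is
-- everything.
theorem forall_hom_dualKernel_eq_zero_iff (hX : InFinAdd (A := A) E X)
    (hY : InFinAdd (A := A) E Y) (f : X →ₗ[A] Y) :
    (∀ φ : (E →ₗ[A] M) →ₗ[CMAuslander A E] dualKernel k E (CMAuslander A E) f, φ = 0) ↔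
      Function.Surjective (precomp k M f) := by
  constructor
  · intro h
    rw [← LinearMap.range_eq_top]
    by_contra hne
    obtain ⟨μ, hμ, hμ'⟩ := Submodule.exists_le_ker_of_lt_top _ (lt_top_iff_ne_top.2 hne)
    refine hμ (hX.dualPairing_injective k ?_)
    have h0 : μ ∘ₗ precomp k M f = 0 := LinearMap.ext fun u => hμ' ⟨u, rfl⟩
    have := h ((dualPairing k E X M μ).codRestrict _ fun h => by
      rw [LinearMap.mem_ker, map_dualPairing, h0]
      rfl)
    exact LinearMap.ext fun g => congrArg Subtype.val (LinearMap.congr_fun this g)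
  · intro hs φ
    obtain ⟨μ, hμ⟩ := hX.dualPairing_surjective k (M := M)
      ((dualKernel k E (CMAuslander A E) f).subtype ∘ₗ φ)
    have h0 : μ ∘ₗ precomp k M f = 0 := by
      refine hY.dualPairing_injective k (LinearMap.ext fun h => ?_)
      rw [← map_dualPairing, hμ]
      exact (φ h).2
    have h1 : μ = 0 := by
      ext u
      obtain ⟨v, rfl⟩ := hs u
      exact LinearMap.congr_fun h0 v
    subst h1
    exact LinearMap.ext fun h => Subtype.ext (LinearMap.congr_fun hμ h).symm

end Pairing

/-! ### Maps out of `Hom_A(E, Y)` for `Y` in `Gen_G M` -/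

section Generation

variable {A E M : Type u} [Ring A] [AddCommGroup E] [Module A E] [AddCommGroup M] [Module A M]

/-- If `Y` is in `Gen_G M`, then every map on `Hom_A(E, Y)` that vanishes on all images of
`Hom_A(E, M)` is zero. -/
theorem InGenG.hom_eq_zero [Module.Finite A E] (hE : IsGproj A E) {Y : Type u} [AddCommGroup Y]
    [Module A Y] (hY : InGenG A M Y) {T : Type*} [AddCommGroup T] [Module (CMAuslander A E) T]
    (hT : ∀ φ : (E →ₗ[A] M) →ₗ[CMAuslander A E] T, φ = 0)
    (φ : (E →ₗ[A] Y) →ₗ[CMAuslander A E] T) : φ = 0 := by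
  classical
  obtain ⟨T₀, g, ⟨I, i, r, hri⟩, -, hg⟩ := hY
  refine LinearMap.ext fun h => ?_
  obtain ⟨h', rfl⟩ := hg (ModuleCat.of A E) hE h
  obtain ⟨S, hS⟩ := Module.Finite.fg_top (R := A) (M := E)
  -- The direct sum may be infinite, but `E` is finitely generated, so its image lies in finitely
  -- many copies of `M`.
  let J : Finset I := S.biUnion fun x => (i (h' x)).support
  have hJ : i ∘ₗ h' = ∑ j ∈ J, Finsupp.lsingle j ∘ₗ Finsupp.lapply j ∘ₗ i ∘ₗ h' := by
    refine LinearMap.ext_on hS fun x hx => ?_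
    simp only [LinearMap.sum_apply, LinearMap.comp_apply, Finsupp.lapply_apply,
      Finsupp.lsingle_apply]
    conv_lhs => rw [← Finsupp.sum_single (i (h' x))]
    exact Finset.sum_subset (Finset.subset_biUnion_of_mem (fun x => (i (h' x)).support) hx)
      fun j _ hj => by rw [Finsupp.notMem_support_iff.1 hj, Finsupp.single_zero]
  have key : g ∘ₗ h' = ∑ j ∈ J, homMap E (g ∘ₗ r ∘ₗ Finsupp.lsingle j)
      (Finsupp.lapply j ∘ₗ i ∘ₗ h') := by
    ext x
    have h1 : h' x = r (i (h' x)) := (LinearMap.congr_fun hri (h' x)).symm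
    have h2 := LinearMap.congr_fun hJ x
    rw [LinearMap.comp_apply] at h2
    rw [LinearMap.comp_apply, h1, h2]
    simp only [LinearMap.sum_apply, map_sum, homMap_apply, LinearMap.comp_apply]
  change φ (g ∘ₗ h') = 0
  rw [key, map_sum]
  exact Finset.sum_eq_zero fun j _ =>
    LinearMap.congr_fun (hT (φ ∘ₗ homMap E (g ∘ₗ r ∘ₗ Finsupp.lsingle j))) _

end Generation

end RelAR

/-! ### The main theorem -/

theorem mainTheorem2 (k A E M : Type u) [Field k] [Ring A] [Algebra k A] [Module.Finite k A]
    [AddCommGroup E] [Module k E] [Module A E] [IsScalarTower k A E] [Module.Finite A E]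
    (hE : RelAR.IsGprojGenerator A E)
    [AddCommGroup M] [Module A M] [Module.Finite A M] :
    haveI : Module.Finite (RelAR.CMAuslander A E) (E →ₗ[A] M) :=
      RelAR.finite_hom_CMAuslander k A E M
    Nonempty (RelAR.MinimalGprojPresentation A M) ∧
    ∀ P : RelAR.MinimalGprojPresentation A M,
      (RelAR.IsTauGRigid k A E M ↔
        Function.Surjective (fun φ : P.X₀ →ₗ[A] M => φ ∘ₗ P.f)) ∧
      (RelAR.IsTauGRigid k A E M ↔
        RelAR.IsTauRigid k (RelAR.CMAuslander A E) (E →ₗ[A] M)) ∧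
      Nonempty (RelAR.tauG k E P ≃ₗ[RelAR.CMAuslander A E]
        RelAR.tau k (RelAR.CMAuslander A E) (E →ₗ[A] M)) ∧
      (RelAR.IsTauGRigid k A E M →
        ∀ (Y : Type u) [AddCommGroup Y] [Module A Y] [Module.Finite A Y],
          RelAR.InGenG A M Y →
          RelAR.InStablePerp (RelAR.CMAuslander A E) (RelAR.tauG k E P) (E →ₗ[A] Y)) := by
  have : Module.Finite (RelAR.CMAuslander A E) (E →ₗ[A] M) :=
    RelAR.finite_hom_CMAuslander k A E M
  have : IsArtinianRing A := IsArtinianRing.of_finite k A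
  let _ : Module k M := Module.compHom M (algebraMap k A)
  have : IsScalarTower k A M := IsScalarTower.of_algebraMap_smul fun _ _ => rfl
  have hadd : ∀ X : ModuleCat.{u} A, RelAR.IsGproj A X → RelAR.InFinAdd (A := A) E X :=
    fun X hX => hE.inFinAdd hX
  have htau (P : RelAR.MinimalGprojPresentation A M) :=
    RelAR.nonempty_tauG_equiv_tau k E hE.isGproj hadd P
  have hrigid (P : RelAR.MinimalGprojPresentation A M) :
      (∀ φ : (E →ₗ[A] M) →ₗ[RelAR.CMAuslander A E] RelAR.tauG k E P, φ = 0) ↔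
        RelAR.IsTauRigid k (RelAR.CMAuslander A E) (E →ₗ[A] M) := by
    obtain ⟨e⟩ := htau P
    constructor
    · intro h φ
      have := h (e.symm.toLinearMap ∘ₗ φ)
      exact LinearMap.ext fun x =>
        (map_eq_zero_iff _ e.symm.injective).1 (LinearMap.congr_fun this x)
    · intro h φ
      have := h (e.toLinearMap ∘ₗ φ)
      exact LinearMap.ext fun x => (map_eq_zero_iff _ e.injective).1 (LinearMap.congr_fun this x)
  have hne : Nonempty (RelAR.MinimalGprojPresentation A M) :=
    hE.nonempty_minimalGprojPresentation
      (fun M _ _ _ => RelAR.finite_hom_CMAuslander k A E M) M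
  -- `IsTauGRigid` asks for some presentation, the claims concern every one; `τ`-rigidity of
  -- `Hom_A(E, M)` involves neither and links them.
  have hrigid' : RelAR.IsTauGRigid k A E M ↔
      RelAR.IsTauRigid k (RelAR.CMAuslander A E) (E →ₗ[A] M) := by
    obtain ⟨P⟩ := hne
    exact ⟨fun ⟨P, hP⟩ => (hrigid P).1 hP, fun h => ⟨P, (hrigid P).2 h⟩⟩
  refine ⟨hne, fun P => ⟨?_, hrigid', htau P, fun hM Y _ _ _ hY => ⟨?_, fun φ => ?_⟩⟩⟩
  · rw [hrigid', ← hrigid P]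
    exact RelAR.forall_hom_dualKernel_eq_zero_iff k (hadd _ P.mem₁) (hadd _ P.mem₀) P.f
  · exact RelAR.finite_hom_CMAuslander k A E Y
  -- Every such map is zero, so it factors through the zero module.
  · refine ⟨ModuleCat.of _ PUnit.{u + 1}, 0, 0, inferInstanceAs (Module.Finite _ PUnit.{u + 1}), ?_,
      ?_⟩
    · exact ⟨fun X Y _ _ _ _ f hf g => ⟨0, fun x => Subsingleton.elim (α := PUnit.{u + 1}) _ _⟩⟩
    · rw [hY.hom_eq_zero hE.isGproj ((hrigid P).2 (hrigid'.1 hM)) φ, LinearMap.zero_comp]
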